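/- For complex numbers $a_{00},a_{10},a_{01},a_{11}$, not all zero, set $$\gamma_{00}=a_{00}^2+a_{10}^2+a_{01}^2+a_{11}^2,\quad \gamma_{10}=a_{00}a_{10}+a_{01}a_{11},\quad \gamma_{01}=a_{00}a_{01}+a_{10}a_{11},\quad \gamma_{1,-1}=a_{10}a_{01},\quad \gamma_{11}=a_{00}a_{11};$$ these are the autocovariances $\gamma(t)=\sum_k a_k a_{k+t}$ of the moving average random field $Y_t=\sum_{k\in\{0,1\}^2}a_kZ_{t-k}$ on $\mathbb Z^2$ driven by white noise of variance $1$. Let $\mathcal{MA}_{(1,1)}\subseteq\mathbb P^4$ be the image of the resulting map $\mathbb P^3\dashrightarrow\mathbb P^4$ over $\mathbb C$, where $\mathbb P^4$ has homogeneous coordinates $g_{00},g_{10},g_{01},g_{11},g_{1,-1}$. **Theorem.** $\mathcal{MA}_{(1,1)}$ is a threefold (a closed irreducible subset of $\mathbb P^4$ of dimension $3$) of degree $4$. It is the hypersurface defined by the quartic $$\begin{aligned} & g_{10}^2 g_{01}^2 -g_{00} g_{10} g_{01} g_{11} +g_{10}^2 g_{11}^2 +g_{01}^2 g_{11}^2 -g_{00}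 g_{10} g_{01} g_{1,-1} +g_{00}^2 g_{11} g_{1,-1} -2 g_{10}^2 g_{11} g_{1,-1}\\ &\quad -2 g_{01}^2 g_{11} g_{1,-1} -4 g_{11}^3 g_{1,-1} +g_{10}^2 g_{1,-1}^2 +g_{01}^2 g_{1,-1}^2 +8 g_{11}^2 g_{1,-1}^2 -4 g_{11} g_{1,-1}^3, \end{aligned}$$ and its homogeneous ideal in $\mathbb C[g_{00},g_{10},g_{01},g_{11},g_{1,-1}]$ is generated by this quartic. Its singular locus is a quadratic surface, in the sense that it is a projective algebraic set of dimension $2$ and degree $2$ (as read off from its Hilbert polynomial; its components need not have the same dimension). The singular locus is the union of exactly three irreducible components, namely the zero loci of the ideals $$\langle g_{10}-g_{01},\; g_{00}-2g_{11}-2g_{1,-1},\; 4g_{11}g_{1,-1}-g_{01}^2\rangle,$$ $$\langle g_{10}+g_{01},\; g_{00}+2g_{11}+2g_{1,-1},\; 4g_{11}g_{1,-1}-g_{01}^2\rangle,$$ $$\langle g_{11}-g_{1,-1},\; g_{00}g_{1,-1}-g_{10}g_{01}\rangle.$$ These three ideals are prime, and each is the homogeneous vanishing ideal of its zero locus. 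-/

import Mathlib

open scoped LinearAlgebra.Projectivization

noncomputable section

namespace AutocovVariety

/-! ### Projective algebraic sets over the complex numbers -/

/-- Complex projective space with homogeneous coordinates indexed by `σ`, to be equipped with the
Zariski topology. -/
def ProjSpace (σ : Type) : Type := ℙ ℂ (σ → ℂ)

/-- The common zeros in projective space of the homogeneous polynomials that belong to `T`.
(Whether a homogeneous polynomial vanishes does not depend on the representative chosen.) -/
def zeroLocus {σ : Type} (T : Set (MvPolynomial σ ℂ)) : Set (ProjSpace σ) :=
  {p | ∀ f ∈ T, ∀ n : ℕ, f.IsHomogeneous n → MvPolynomial.eval (Projectivization.rep p) f = 0}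

/-- The Zariski topology: the closed sets are the zero loci. -/
instance zariskiTopology (σ : Type) : TopologicalSpace (ProjSpace σ) :=
  TopologicalSpace.ofClosed {Z | ∃ T : Set (MvPolynomial σ ℂ), Z = zeroLocus T}
    ⟨{1}, by
      ext p
      simp only [Set.mem_empty_iff_false, zeroLocus, Set.mem_ofPred_eq, false_iff]
      intro h
      simpa using h 1 rfl 0 (MvPolynomial.isHomogeneous_one σ ℂ)⟩
    (by
      intro A hA
      refine ⟨{f | ∃ T : Set (MvPolynomial σ ℂ), zeroLocus T ∈ A ∧ f ∈ T}, ?_⟩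
      ext p
      constructor
      · rintro h f ⟨T, hT, hf⟩ n hn
        exact h _ hT f hf n hn
      · intro h Z hZ
        obtain ⟨T, rfl⟩ := hA hZ
        intro f hf n hn
        exact h f ⟨T, hZ, hf⟩ n hn)
    (by
      rintro _ ⟨T, rfl⟩ _ ⟨U, rfl⟩
      refine ⟨{h | ∃ f ∈ T, ∃ g ∈ U, ∃ m n : ℕ,
        f.IsHomogeneous m ∧ g.IsHomogeneous n ∧ h = f * g}, ?_⟩
      ext p
      constructor
      · rintro (hp | hp)
        · rintro _ ⟨f, hf, g, -, m, n, hfm, -, rfl⟩ _ -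
          rw [map_mul, hp f hf m hfm, zero_mul]
        · rintro _ ⟨f, -, g, hg, m, n, -, hgn, rfl⟩ _ -
          rw [map_mul, hp g hg n hgn, mul_zero]
      · intro hp
        by_contra hcon
        simp only [Set.mem_union, not_or, zeroLocus, Set.mem_ofPred_eq, not_forall] at hcon
        obtain ⟨⟨f, hf, m, hfm, hf0⟩, g, hg, n, hgn, hg0⟩ := hcon
        have := hp (f * g) ⟨f, hf, g, hg, m, n, hfm, hgn, rfl⟩ (m + n) (hfm.mul hgn)
        rw [map_mul] at this
        exact (mul_ne_zero hf0 hg0) this)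

/-- The homogeneous ideal of a set of points: the ideal generated by all homogeneous polynomials
that vanish on it. -/
def vanishingIdeal {σ : Type} (X : Set (ProjSpace σ)) : Ideal (MvPolynomial σ ℂ) :=
  Ideal.span {f | (∃ n : ℕ, f.IsHomogeneous n) ∧
    ∀ p ∈ X, MvPolynomial.eval (Projectivization.rep p) f = 0}

/-- The Hilbert function of `X`: the dimension of the degree `m` part of the homogeneous
coordinate ring of `X`. -/
def hilbertFunction {σ : Type} (X : Set (ProjSpace σ)) (m : ℕ) : ℕ :=
  Module.finrank ℂ ((MvPolynomial.homogeneousSubmodule σ ℂ m).map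
    (Ideal.Quotient.mkₐ ℂ (vanishingIdeal X)).toLinearMap)

/-- `X` has degree `e`: there is a Hilbert polynomial `P` of `X`, that is, a polynomial that
agrees with the Hilbert function for all large arguments, and `e` is its leading coefficient
multiplied by the factorial of its degree. -/
def HasDegree {σ : Type} (X : Set (ProjSpace σ)) (e : ℕ) : Prop :=
  ∃ P : Polynomial ℚ,
    (∀ᶠ m : ℕ in Filter.atTop, (hilbertFunction X m : ℚ) = P.eval (m : ℚ)) ∧
    P.leadingCoeff * (P.natDegree.factorial : ℚ) = (e : ℚ)

/-- The Zariski tangent space at `p` of the affine cone over `X`: the kernel of the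
Jacobian matrix, at a representative of `p`, of the polynomials in the ideal of `X`. -/
def tangentSpace {σ : Type} [Fintype σ] (X : Set (ProjSpace σ)) (p : ProjSpace σ) :
    Submodule ℂ (σ → ℂ) where
  carrier := {v | ∀ f ∈ vanishingIdeal X,
    ∑ i, MvPolynomial.eval (Projectivization.rep p) (MvPolynomial.pderiv i f) * v i = 0}
  zero_mem' := by intro f _; simp
  add_mem' := by
    intro v w hv hw f hf
    simp [mul_add, Finset.sum_add_distrib, hv f hf, hw f hf]
  smul_mem' := by
    intro c v hv f hf
    have h := congrArg (fun z => c * z) (hv f hf)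
    simp only [Finset.mul_sum, mul_zero] at h
    rw [← h]
    exact Finset.sum_congr rfl fun i _ => by simp only [Pi.smul_apply, smul_eq_mul]; ring

/-- The singular locus of an irreducible closed set `X`: the points at which the dimension of the
tangent space of the affine cone exceeds the dimension `dim X + 1` of that cone. -/
def singularLocus {σ : Type} [Fintype σ] (X : Set (ProjSpace σ)) : Set (ProjSpace σ) :=
  {p | p ∈ X ∧ topologicalKrullDim X + 1 < (Module.finrank ℂ (tangentSpace X p) : WithBot ℕ∞)}

/-! ### Autocovariance varieties -/

/-- The box `[0, q]` in `ℤ^d`, indexing the moving average coefficients. -/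
abbrev CoeffIndex {d : ℕ} (q : Fin d → ℕ) : Type :=
  ↥(Finset.Icc (0 : Fin d → ℤ) (fun i => (q i : ℤ)))

open Classical in
/-- The points `t` of the box `[-q, q]` in `ℤ^d` with `0 ≤ t` in the lexicographic order, indexing
the autocovariances. -/
abbrev AutocovIndex {d : ℕ} (q : Fin d → ℕ) : Type :=
  ↥((Finset.Icc (fun i => -(q i : ℤ)) (fun i => (q i : ℤ))).filter
    (fun t : Fin d → ℤ => (0 : Lex (Fin d → ℤ)) ≤ toLex t))

/-- The coefficients `a`, extended by zero to all of `ℤ^d`. -/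
def coeffExt {d : ℕ} (q : Fin d → ℕ) (a : CoeffIndex q → ℂ) (k : Fin d → ℤ) : ℂ :=
  if h : k ∈ Finset.Icc (0 : Fin d → ℤ) (fun i => (q i : ℤ)) then a ⟨k, h⟩ else 0

/-- The autocovariance map `a ↦ (γ(t))_t`, where `γ(t) = ∑ a_k a_{k+t}`, the sum over all `k` with
`k` and `k + t` in `[0, q]`, is the lag `t` autocovariance of `Y_t = ∑_k a_k Z_{t-k}` for a white
noise `Z` with variance one. -/
def autocovMap {d : ℕ} (q : Fin d → ℕ) (a : CoeffIndex q → ℂ) : AutocovIndex q → ℂ :=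
  fun t => ∑ k : CoeffIndex q, a k * coeffExt q a (k.1 + t.1)

/-- The autocovariance variety: the image in projective space of the autocovariance map. -/
def MA {d : ℕ} (q : Fin d → ℕ) : Set (ProjSpace (AutocovIndex q)) :=
  {p | ∃ (a : CoeffIndex q → ℂ) (h : autocovMap q a ≠ 0),
    p = Projectivization.mk ℂ (autocovMap q a) h}

/-! ### The case `q = (1, 1)` -/

/-- The order `(1, 1)`. -/
abbrev q11 : Fin 2 → ℕ := ![1, 1]

/-- A lag `(s, t)`, with `s` and `t` in `{-1, 0, 1}`, that is lexicographically nonnegative. -/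
def lag (s t : ℤ) (hs : -1 ≤ s ∧ s ≤ 1) (ht : -1 ≤ t ∧ t ≤ 1) (h : 0 < s ∨ s = 0 ∧ 0 ≤ t) :
    AutocovIndex q11 :=
  ⟨![s, t], by
    rw [Finset.mem_filter, Finset.mem_Icc]
    refine ⟨⟨?_, ?_⟩, ?_⟩
    · intro i; fin_cases i <;> simp [hs.1, ht.1]
    · intro i; fin_cases i <;> simp [hs.2, ht.2]
    · rcases h with h | ⟨rfl, h⟩
      · exact le_of_lt ⟨0, by simp, h⟩
      · rcases h.eq_or_lt with rfl | h
        · refine le_of_eq ?_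
          funext i
          fin_cases i <;> rfl
        · refine le_of_lt ⟨1, ?_, h⟩
          intro j hj
          fin_cases j
          · rfl
          · simp at hj⟩

/-- The homogeneous coordinate ring of the ambient projective space, a polynomial ring in the five
variables `g_t`. -/
abbrev CoordRing : Type := MvPolynomial (AutocovIndex q11) ℂ

/-- The variable `g_{00}`. -/
def g00 : CoordRing := MvPolynomial.X (lag 0 0 (by norm_num) (by norm_num) (by norm_num))

/-- The variable `g_{10}`. -/
def g10 : CoordRing := MvPolynomial.X (lag 1 0 (by norm_num) (by norm_num) (by norm_num))

/-- The variable `g_{01}`. -/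
def g01 : CoordRing := MvPolynomial.X (lag 0 1 (by norm_num) (by norm_num) (by norm_num))

/-- The variable `g_{11}`. -/
def g11 : CoordRing := MvPolynomial.X (lag 1 1 (by norm_num) (by norm_num) (by norm_num))

/-- The variable `g_{1,-1}`. -/
def g1m : CoordRing := MvPolynomial.X (lag 1 (-1) (by norm_num) (by norm_num) (by norm_num))

/-- The quartic. -/
def quartic : CoordRing :=
  g10 ^ 2 * g01 ^ 2 - g00 * g10 * g01 * g11 + g10 ^ 2 * g11 ^ 2 + g01 ^ 2 * g11 ^ 2
    - g00 * g10 * g01 * g1m + g00 ^ 2 * g11 * g1m - 2 * g10 ^ 2 * g11 * g1m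
    - 2 * g01 ^ 2 * g11 * g1m - 4 * g11 ^ 3 * g1m + g10 ^ 2 * g1m ^ 2 + g01 ^ 2 * g1m ^ 2
    + 8 * g11 ^ 2 * g1m ^ 2 - 4 * g11 * g1m ^ 3

/-- The ideal of the first component. -/
def P1 : Ideal CoordRing :=
  Ideal.span {g10 - g01, g00 - 2 * g11 - 2 * g1m, 4 * g11 * g1m - g01 ^ 2}

/-- The ideal of the second component. -/
def P2 : Ideal CoordRing :=
  Ideal.span {g10 + g01, g00 + 2 * g11 + 2 * g1m, 4 * g11 * g1m - g01 ^ 2}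

/-- The ideal of the third component. -/
def P3 : Ideal CoordRing :=
  Ideal.span {g11 - g1m, g00 * g1m - g10 * g01}

end AutocovVariety

end

open AutocovVariety

namespace AutocovVariety

/-! ### Homogeneous polynomials and points of projective space -/

section General

variable {σ : Type}

attribute [local instance] MvPolynomial.gradedAlgebra

/-! Write w, a, b, h, m for the coordinates g00, g10, g01, g11, g1m and u, x, y, v for the
coefficients a00, a10, a01, a11. Put c = u² + v² and d = x² + y². Then c + d = w, cm + dh = ab and
cd = a² + b² - 4hm. For m ≠ h the first two equations determine c and d linearly, and substituting
them into the third gives exactly the quartic, in the form (ab - wh)(ab - wm) = (m - h)²(4hm - a² -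
b²). Conversely, from any c, d satisfying the three equations, the numbers u ± v and x ± y are
recovered as square roots of c ± 2h and d ± 2m, with signs matched by (u ± v)(x ± y) = a ± b
(`exists_autocov`). Hence the image is the whole quartic hypersurface, and no closure is needed.

The quartic is a primitive quadratic polynomial in g00 whose discriminant is not a square, hence
prime (`isPrime_span_quartic`), and the homogeneous Nullstellensatz identifies the ideal of the
variety. Irreducibility comes from the parametrization. Dimensions are bounded above by prolonging
chains of homogeneous primes by the irrelevant ideal inside a ring of dimension 5, and below by the
chain point, line, quadric surface, variety.

For a hypersurface the singular points are the zeros of the gradient. On h = m the quartic is the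
square of wm - ab, which gives the quadric surface of `P3`; off h = m the gradient forces a = ±b and
then one of the two conics of `P1` and `P2` (`gradient_eq_zero_iff`).

The degree 4 follows from the Hilbert function of a hypersurface. For the singular locus, forms are
pulled back to the Segre parametrization of the surface and to the parametrizations of both conics.
The Segre part in degree n contributes (n + 1)². The forms vanishing on the surface restrict to
multiples of s² - t² on each conic, and since the conics are disjoint every pair of such multiples
occurs once n ≥ 3; this contributes 2(2n - 1). The Hilbert polynomial is therefore n² + 6n - 1, and
the conics do not affect the degree 2 (`hilbertFunction_singularLocus`). -/

theorem eval_smul_of_isHomogeneous {f : MvPolynomial σ ℂ} {n : ℕ} (hf : f.IsHomogeneous n)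
    (c : ℂ) (v : σ → ℂ) :
    MvPolynomial.eval (c • v) f = c ^ n * MvPolynomial.eval v f := by
  rw [MvPolynomial.eval_eq, MvPolynomial.eval_eq, Finset.mul_sum]
  refine Finset.sum_congr rfl fun d hd => ?_
  have hdeg : d.degree = n := by
    by_contra hne
    exact MvPolynomial.mem_support_iff.1 hd (hf.coeff_eq_zero hne)
  have : ∏ i ∈ d.support, c ^ d i = c ^ n := by
    rw [Finset.prod_pow_eq_pow_sum, ← hdeg, Finsupp.degree_apply]
  simp only [Pi.smul_apply, smul_eq_mul, mul_pow, Finset.prod_mul_distrib, this]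
  ring

/-- The point of projective space with the given homogeneous coordinates. -/
noncomputable def point (v : σ → ℂ) (h : v ≠ 0) : ProjSpace σ := Projectivization.mk ℂ v h

theorem exists_eq_point (p : ProjSpace σ) : ∃ v h, p = point (σ := σ) v h :=
  ⟨Projectivization.rep p, Projectivization.rep_nonzero p, (Projectivization.mk_rep p).symm⟩

theorem eval_rep_point_eq_zero_iff {f : MvPolynomial σ ℂ} {n : ℕ} (hf : f.IsHomogeneous n)
    {v : σ → ℂ} (h : v ≠ 0) :
    MvPolynomial.eval (Projectivization.rep (point v h)) f = 0 ↔ MvPolynomial.eval v f = 0 := by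
  obtain ⟨a, ha⟩ := Projectivization.exists_smul_eq_mk_rep ℂ v h
  have : Projectivization.rep (point v h) = (a : ℂ) • v := ha.symm
  rw [this, eval_smul_of_isHomogeneous hf]
  simp

theorem point_mem_zeroLocus_iff {T : Set (MvPolynomial σ ℂ)} {v : σ → ℂ} (h : v ≠ 0) :
    point v h ∈ zeroLocus T ↔
      ∀ f ∈ T, ∀ n : ℕ, f.IsHomogeneous n → MvPolynomial.eval v f = 0 :=
  forall₂_congr fun _ _ => forall₂_congr fun _ hf => eval_rep_point_eq_zero_iff hf h

theorem point_mem_zeroLocus_span_iff {S : Set (MvPolynomial σ ℂ)}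
    (hS : ∀ f ∈ S, ∃ n : ℕ, f.IsHomogeneous n) {v : σ → ℂ} (h : v ≠ 0) :
    point v h ∈ zeroLocus (Ideal.span S : Set (MvPolynomial σ ℂ)) ↔
      ∀ f ∈ S, MvPolynomial.eval v f = 0 := by
  rw [point_mem_zeroLocus_iff]
  constructor
  · intro H f hf
    obtain ⟨n, hn⟩ := hS f hf
    exact H f (Ideal.subset_span hf) n hn
  · intro H f hf n _
    have : Ideal.span S ≤ RingHom.ker (MvPolynomial.eval v) := Ideal.span_le.2 H
    exact this hf

theorem isClosed_iff_exists_zeroLocus {Z : Set (ProjSpace σ)} :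
    IsClosed Z ↔ ∃ T : Set (MvPolynomial σ ℂ), Z = zeroLocus T :=
  isOpen_compl_iff.symm.trans (by
    change Zᶜᶜ ∈ {Z | ∃ T : Set (MvPolynomial σ ℂ), Z = zeroLocus T} ↔ _
    rw [compl_compl]
    rfl)

theorem isClosed_zeroLocus (T : Set (MvPolynomial σ ℂ)) : IsClosed (zeroLocus T) :=
  isClosed_iff_exists_zeroLocus.2 ⟨T, rfl⟩

/-! ### The homogeneous vanishing ideal -/

theorem eval_rep_eq_zero_of_mem_vanishingIdeal {X : Set (ProjSpace σ)} {f : MvPolynomial σ ℂ}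
    (hf : f ∈ vanishingIdeal X) {p : ProjSpace σ} (hp : p ∈ X) :
    MvPolynomial.eval (Projectivization.rep p) f = 0 := by
  have : vanishingIdeal X ≤ RingHom.ker (MvPolynomial.eval (Projectivization.rep p)) :=
    Ideal.span_le.2 fun g hg => hg.2 p hp
  exact this hf

theorem mem_vanishingIdeal_iff {X : Set (ProjSpace σ)} {f : MvPolynomial σ ℂ} {n : ℕ}
    (hf : f.IsHomogeneous n) :
    f ∈ vanishingIdeal X ↔ ∀ p ∈ X, MvPolynomial.eval (Projectivization.rep p) f = 0 :=
  ⟨fun h _ hp => eval_rep_eq_zero_of_mem_vanishingIdeal h hp,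
    fun h => Ideal.subset_span ⟨⟨n, hf⟩, h⟩⟩

theorem vanishingIdeal_anti {X Y : Set (ProjSpace σ)} (h : X ⊆ Y) :
    vanishingIdeal Y ≤ vanishingIdeal X :=
  Ideal.span_mono fun _ hf => ⟨hf.1, fun p hp => hf.2 p (h hp)⟩

theorem vanishingIdeal_union (X Y : Set (ProjSpace σ)) {f : MvPolynomial σ ℂ} {n : ℕ}
    (hf : f.IsHomogeneous n) :
    f ∈ vanishingIdeal (X ∪ Y) ↔ f ∈ vanishingIdeal X ∧ f ∈ vanishingIdeal Y := by
  simp only [mem_vanishingIdeal_iff hf, Set.mem_union, or_imp, forall_and]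

theorem isHomogeneous_vanishingIdeal (X : Set (ProjSpace σ)) :
    (vanishingIdeal X).IsHomogeneous (MvPolynomial.homogeneousSubmodule σ ℂ) :=
  Ideal.homogeneous_span _ _ fun _ hf => hf.1

theorem zeroLocus_vanishingIdeal {Z : Set (ProjSpace σ)} (hZ : IsClosed Z) :
    zeroLocus (vanishingIdeal Z : Set (MvPolynomial σ ℂ)) = Z := by
  obtain ⟨T, rfl⟩ := isClosed_iff_exists_zeroLocus.1 hZ
  refine Set.Subset.antisymm (fun p hp f hf n hn => ?_) fun p hp f hf n _ =>
    eval_rep_eq_zero_of_mem_vanishingIdeal hf hp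
  exact hp f ((mem_vanishingIdeal_iff hn).2 fun q hq => hq f hf n hn) n hn

theorem vanishingIdeal_ne_top {X : Set (ProjSpace σ)} (hX : X.Nonempty) :
    vanishingIdeal X ≠ ⊤ := by
  obtain ⟨p, hp⟩ := hX
  intro h
  have := eval_rep_eq_zero_of_mem_vanishingIdeal (f := 1) (h ▸ Submodule.mem_top) hp
  simp at this

/-- Primality of a homogeneous ideal may be tested on homogeneous elements; a product of two forms
vanishing on X covers X by their two closed zero loci, so irreducibility places X inside one of
them. -/
theorem isPrime_vanishingIdeal {X : Set (ProjSpace σ)} (hX : IsIrreducible X) :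
    (vanishingIdeal X).IsPrime := by
  refine (isHomogeneous_vanishingIdeal X).isPrime_of_homogeneous_mem_or_mem
    (vanishingIdeal_ne_top hX.nonempty) ?_
  rintro f g ⟨m, hf⟩ ⟨n, hg⟩ hfg
  have hf' : f.IsHomogeneous m := hf
  have hg' : g.IsHomogeneous n := hg
  have hcov : X ⊆ zeroLocus {f} ∪ zeroLocus {g} := by
    intro p hp
    have := eval_rep_eq_zero_of_mem_vanishingIdeal hfg hp
    rw [map_mul, mul_eq_zero] at this
    refine this.imp ?_ ?_ <;> rintro h _ rfl _ _ <;> exact h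
  refine (isPreirreducible_iff_isClosed_union_isClosed.1 hX.isPreirreducible _ _
    (isClosed_zeroLocus _) (isClosed_zeroLocus _) hcov).imp (fun h => ?_) fun h => ?_
  · exact (mem_vanishingIdeal_iff hf').2 fun p hp => h hp f rfl m hf'
  · exact (mem_vanishingIdeal_iff hg').2 fun p hp => h hp g rfl n hg'

/-- The homogeneous Nullstellensatz for a prime ideal with homogeneous generators. -/
theorem vanishingIdeal_zeroLocus_span [Finite σ] {S : Set (MvPolynomial σ ℂ)}
    (hS : ∀ f ∈ S, ∃ n : ℕ, f.IsHomogeneous n) (hP : (Ideal.span S).IsPrime)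
    (hne : (zeroLocus (Ideal.span S : Set (MvPolynomial σ ℂ))).Nonempty) :
    vanishingIdeal (zeroLocus (Ideal.span S : Set (MvPolynomial σ ℂ))) = Ideal.span S := by
  apply le_antisymm
  · refine Ideal.span_le.2 ?_
    rintro f ⟨⟨n, hn⟩, hf⟩
    rw [← MvPolynomial.IsPrime.vanishingIdeal_zeroLocus (K := ℂ) (Ideal.span S)]
    intro x hx
    have hx' : ∀ g ∈ Ideal.span S, MvPolynomial.eval x g = 0 := hx
    change MvPolynomial.eval x f = 0
    -- The origin of the affine cone is not a projective point. There a form of positive degree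
    -- vanishes automatically, and a constant form is zero because it vanishes at some point of the
    -- nonempty zero locus.
    by_cases h0 : x = 0
    · rcases Nat.eq_zero_or_pos n with rfl | hpos
      · obtain ⟨p, hp⟩ := hne
        have hc := MvPolynomial.totalDegree_eq_zero_iff_eq_C.1
          ((MvPolynomial.totalDegree_zero_iff_isHomogeneous σ).2 hn)
        have := hf p hp
        rw [hc, MvPolynomial.eval_C] at this
        rw [hc, this]
        simp
      · have := eval_smul_of_isHomogeneous hn 0 x
        rw [zero_smul, zero_pow hpos.ne', zero_mul] at this
        rw [h0, this]
    · exact (eval_rep_point_eq_zero_iff hn h0).1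
        (hf _ ((point_mem_zeroLocus_iff h0).2 fun g hg _ _ => hx' g hg))
  · refine Ideal.span_le.2 fun f hf => ?_
    obtain ⟨n, hn⟩ := hS f hf
    exact (mem_vanishingIdeal_iff hn).2 fun p hp => hp f (Ideal.subset_span hf) n hn

/-! ### Parametrized sets -/

/-- The set of points of projective space parametrized by a family of polynomials. -/
def parametrizedSet {ι : Type} (φ : σ → MvPolynomial ι ℂ) : Set (ProjSpace σ) :=
  {p | ∃ (a : ι → ℂ) (h : (fun j => MvPolynomial.eval a (φ j)) ≠ 0), p = point _ h}

theorem eval_aeval {ι : Type} (φ : σ → MvPolynomial ι ℂ) (a : ι → ℂ) (f : MvPolynomial σ ℂ) :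
    MvPolynomial.eval a (MvPolynomial.aeval φ f) =
      MvPolynomial.eval (fun j => MvPolynomial.eval a (φ j)) f := by
  have : (MvPolynomial.eval a).comp (MvPolynomial.aeval φ).toRingHom =
      MvPolynomial.eval (fun j => MvPolynomial.eval a (φ j)) := by
    apply MvPolynomial.ringHom_ext <;> intro <;> simp
  exact RingHom.congr_fun this f

/-- The base locus of φ is harmless: after multiplication by a nonzero component of φ the pullback
vanishes at every parameter, and the polynomial ring is a domain. -/
theorem aeval_eq_zero_of_forall_mem_parametrizedSet {ι : Type} {φ : σ → MvPolynomial ι ℂ}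
    (hφ : φ ≠ 0) {f : MvPolynomial σ ℂ}
    (hf : ∀ (a : ι → ℂ), (fun j => MvPolynomial.eval a (φ j)) ≠ 0 →
      MvPolynomial.eval (fun j => MvPolynomial.eval a (φ j)) f = 0) :
    MvPolynomial.aeval φ f = 0 := by
  obtain ⟨j, hj⟩ := Function.ne_iff.1 hφ
  have key : MvPolynomial.aeval φ f * φ j = 0 := by
    refine MvPolynomial.funext fun a => ?_
    rw [map_mul, map_zero]
    by_cases ha : (fun j => MvPolynomial.eval a (φ j)) = 0
    · rw [show MvPolynomial.eval a (φ j) = 0 from congrFun ha j, mul_zero]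
    · rw [eval_aeval, hf a ha, zero_mul]
  exact (mul_eq_zero.1 key).resolve_right hj

theorem mem_vanishingIdeal_parametrizedSet_iff {ι : Type} {φ : σ → MvPolynomial ι ℂ}
    (hφ : φ ≠ 0) {f : MvPolynomial σ ℂ} {n : ℕ} (hf : f.IsHomogeneous n) :
    f ∈ vanishingIdeal (parametrizedSet φ) ↔ MvPolynomial.aeval φ f = 0 := by
  rw [mem_vanishingIdeal_iff hf]
  constructor
  · intro H
    exact aeval_eq_zero_of_forall_mem_parametrizedSet hφ fun a ha =>
      (eval_rep_point_eq_zero_iff hf ha).1 (H _ ⟨a, ha, rfl⟩)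
  · rintro H _ ⟨a, ha, rfl⟩
    rw [eval_rep_point_eq_zero_iff hf, ← eval_aeval, H, map_zero]

/-- Irreducibility is inherited from the parameter space: forms f and g witnessing that neither
closed set contains the image would have a product with zero pullback in a domain. Nonemptiness
holds since otherwise the constant 1 would pull back to zero. -/
theorem isIrreducible_parametrizedSet {ι : Type} {φ : σ → MvPolynomial ι ℂ} (hφ : φ ≠ 0) :
    IsIrreducible (parametrizedSet φ) := by
  constructor
  · by_contra hne
    apply one_ne_zero (α := MvPolynomial ι ℂ)
    rw [← map_one (MvPolynomial.aeval (R := ℂ) φ)]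
    exact aeval_eq_zero_of_forall_mem_parametrizedSet hφ
      fun a ha => (hne ⟨_, a, ha, rfl⟩).elim
  · rw [isPreirreducible_iff_isClosed_union_isClosed]
    intro Z₁ Z₂ h₁ h₂ hcov
    obtain ⟨T₁, rfl⟩ := isClosed_iff_exists_zeroLocus.1 h₁
    obtain ⟨T₂, rfl⟩ := isClosed_iff_exists_zeroLocus.1 h₂
    by_contra hcon
    simp only [not_or, Set.not_subset, zeroLocus, Set.mem_ofPred_eq, not_forall] at hcon
    obtain ⟨⟨_, ⟨a, ha, rfl⟩, f, hfT, m, hf, hfa⟩, _, ⟨b, hb, rfl⟩, g, hgT, n, hg, hgb⟩ := hcon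
    have hfg : MvPolynomial.aeval φ (f * g) = 0 := by
      refine aeval_eq_zero_of_forall_mem_parametrizedSet hφ fun c hc => ?_
      rw [map_mul, mul_eq_zero]
      exact (hcov ⟨c, hc, rfl⟩).imp (fun h => (eval_rep_point_eq_zero_iff hf hc).1 (h f hfT m hf))
        fun h => (eval_rep_point_eq_zero_iff hg hc).1 (h g hgT n hg)
    rw [map_mul, mul_eq_zero] at hfg
    rw [eval_rep_point_eq_zero_iff hf, ← eval_aeval] at hfa
    rw [eval_rep_point_eq_zero_iff hg, ← eval_aeval] at hgb
    rcases hfg with h | h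
    · exact hfa (by rw [h, map_zero])
    · exact hgb (by rw [h, map_zero])

end General

/-! ### Irreducible subsets of a subspace -/

theorem isIrreducible_preimage_val {Y : Type*} [TopologicalSpace Y] {S A : Set Y}
    (hA : IsIrreducible A) (hAS : A ⊆ S) : IsIrreducible ((↑) ⁻¹' A : Set S) := by
  constructor
  · obtain ⟨x, hx⟩ := hA.nonempty
    exact ⟨⟨x, hAS hx⟩, hx⟩
  · rw [isPreirreducible_iff_isClosed_union_isClosed]
    intro Z₁ Z₂ h₁ h₂ hcov
    obtain ⟨W₁, hW₁, rfl⟩ := isClosed_induced_iff.1 h₁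
    obtain ⟨W₂, hW₂, rfl⟩ := isClosed_induced_iff.1 h₂
    refine (isPreirreducible_iff_isClosed_union_isClosed.1 hA.isPreirreducible W₁ W₂ hW₁ hW₂
      fun x hx => hcov (show (⟨x, hAS hx⟩ : S) ∈ _ from hx)).imp ?_ ?_ <;>
    exact fun h x hx => h hx

/-- A finite union of closed irreducible sets, none containing another, has exactly these sets as
irreducible components. -/
theorem image_irreducibleComponents_eq {Y : Type*} [TopologicalSpace Y] {S : Set Y}
    (𝒵 : Finset (Set Y)) (hS : S = ⋃₀ ↑𝒵) (hcl : ∀ Z ∈ 𝒵, IsClosed Z)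
    (hirr : ∀ Z ∈ 𝒵, IsIrreducible Z) (hanti : ∀ Z ∈ 𝒵, ∀ W ∈ 𝒵, Z ⊆ W → Z = W) :
    (fun C : Set S => Subtype.val '' C) '' irreducibleComponents S = ↑𝒵 := by
  have hsub : ∀ Z ∈ 𝒵, Z ⊆ S := fun Z hZ => hS ▸ Set.subset_sUnion_of_mem hZ
  have hcov : ∀ T : Set S, IsIrreducible T → ∃ Z ∈ 𝒵, Subtype.val '' T ⊆ Z := fun T hT =>
    isIrreducible_iff_sUnion_isClosed.1 (hT.image _ continuous_subtype_val.continuousOn) 𝒵 hcl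
      (hS ▸ (by rintro _ ⟨x, -, rfl⟩; exact x.2))
  ext Z
  constructor
  · rintro ⟨C, hC, rfl⟩
    obtain ⟨Z, hZ, hCZ⟩ := hcov C hC.1
    have h1 : C ⊆ (↑) ⁻¹' Z := Set.image_subset_iff.1 hCZ
    have h2 : C = (↑) ⁻¹' Z :=
      h1.antisymm (hC.2 (isIrreducible_preimage_val (hirr Z hZ) (hsub Z hZ)) h1)
    have h3 : Subtype.val '' C = Z := by
      rw [h2, Subtype.image_preimage_coe, Set.inter_eq_right.2 (hsub Z hZ)]
    simpa [h3] using hZ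
  · intro hZ
    refine ⟨(↑) ⁻¹' Z, ⟨isIrreducible_preimage_val (hirr Z hZ) (hsub Z hZ), ?_⟩, ?_⟩
    · intro T hT hZT
      obtain ⟨W, hW, hTW⟩ := hcov T hT
      have hZW : Z = W := hanti Z hZ W hW fun x hx =>
        hTW ⟨⟨x, hsub Z hZ hx⟩, hZT (a := ⟨x, hsub Z hZ hx⟩) hx, rfl⟩
      subst hZW
      exact Set.image_subset_iff.1 hTW
    · change Subtype.val '' (Subtype.val ⁻¹' Z) = Z
      rw [Subtype.image_preimage_coe, Set.inter_eq_right.2 (hsub Z hZ)]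

/-! ### Bounds for the dimension -/

theorem le_topologicalKrullDim {Y : Type*} [TopologicalSpace Y] {S : Set Y} {n : ℕ}
    (A : Fin (n + 1) → Set Y) (hA : StrictMono A) (hcl : ∀ i, IsClosed (A i))
    (hirr : ∀ i, IsIrreducible (A i)) (hS : ∀ i, A i ⊆ S) :
    (n : WithBot ℕ∞) ≤ topologicalKrullDim S := by
  let f : Fin (n + 1) → TopologicalSpace.IrreducibleCloseds S := fun i =>
    ⟨(↑) ⁻¹' A i, isIrreducible_preimage_val (hirr i) (hS i),
      (hcl i).preimage continuous_subtype_val⟩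
  have hf : StrictMono f := by
    intro i j hij
    refine lt_of_le_not_ge (fun x hx => (hA hij).le hx) fun h => (hA hij).not_ge fun x hx => ?_
    exact h (show (⟨x, hS j hx⟩ : S) ∈ f j from hx)
  exact Order.LTSeries.length_le_krullDim (LTSeries.mk n f hf)

section General

variable {σ : Type}

attribute [local instance] MvPolynomial.gradedAlgebra

/-- The ideal of a nonempty projective set lies strictly below the irrelevant ideal. This extra step
in a chain of primes accounts for the difference of one between the dimension of a projective set
and that of its affine cone. -/
theorem vanishingIdeal_lt_ker_eval_zero {X : Set (ProjSpace σ)} (hX : X.Nonempty) :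
    vanishingIdeal X < RingHom.ker (MvPolynomial.eval (0 : σ → ℂ)) := by
  obtain ⟨p, hp⟩ := hX
  refine lt_of_le_not_ge (Ideal.span_le.2 ?_) fun h => ?_
  · rintro f ⟨⟨n, hn⟩, hf⟩
    have h0 := hf p hp
    have h1 := eval_smul_of_isHomogeneous hn 0 (Projectivization.rep p)
    rw [zero_smul, h0, mul_zero] at h1
    exact h1
  · refine Projectivization.rep_nonzero p (funext fun i => ?_)
    have := eval_rep_eq_zero_of_mem_vanishingIdeal
      (h (show MvPolynomial.X i ∈ RingHom.ker (MvPolynomial.eval (0 : σ → ℂ)) by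
        simp [RingHom.mem_ker])) hp
    simpa using this

/-- If the prime ideals of the irreducible closed subsets of `X` have height at least `k`, then
`X` has dimension at most `card σ - 1 - k`. -/
theorem topologicalKrullDim_le [Finite σ] {X : Set (ProjSpace σ)} (hX : IsClosed X) {k d : ℕ}
    (hk : ∀ Z ⊆ X, IsClosed Z → ∀ hZ : IsIrreducible Z,
      (k : ℕ∞) ≤ Order.height (⟨vanishingIdeal Z, isPrime_vanishingIdeal hZ⟩ :
        PrimeSpectrum (MvPolynomial σ ℂ)))
    (hd : k + d + 1 = Nat.card σ) :
    topologicalKrullDim X ≤ d := by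
  refine iSup_le fun s => ?_
  let F : TopologicalSpace.IrreducibleCloseds X → PrimeSpectrum (MvPolynomial σ ℂ) := fun C =>
    ⟨vanishingIdeal (Subtype.val '' (C : Set X)), isPrime_vanishingIdeal
      (C.isIrreducible.image _ continuous_subtype_val.continuousOn)⟩
  have hcl : ∀ C : TopologicalSpace.IrreducibleCloseds X,
      IsClosed (Subtype.val '' (C : Set X)) := fun C =>
    hX.isClosedEmbedding_subtypeVal.isClosedMap _ C.isClosed
  have hF : ∀ C D : TopologicalSpace.IrreducibleCloseds X, C < D → F D < F C := by
    intro C D h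
    refine lt_of_le_not_ge (vanishingIdeal_anti (Set.image_mono h.le)) fun h' => h.not_ge ?_
    have h2 : zeroLocus (vanishingIdeal (Subtype.val '' (D : Set X)) : Set (MvPolynomial σ ℂ)) ⊆
        zeroLocus (vanishingIdeal (Subtype.val '' (C : Set X)) : Set (MvPolynomial σ ℂ)) :=
      fun p hp f hf => hp f (h' hf)
    rw [zeroLocus_vanishingIdeal (hcl C), zeroLocus_vanishingIdeal (hcl D)] at h2
    intro x hx
    obtain ⟨y, hy, hyx⟩ := h2 ⟨x, hx, rfl⟩
    rwa [← Subtype.ext hyx]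
  -- Induction from the top of the chain downwards: the largest closed set has height at least k,
  -- and each smaller set adds one.
  have key : ∀ j : ℕ, ∀ i : Fin (s.length + 1), (i : ℕ) + j = s.length →
      ((k + j : ℕ) : ℕ∞) ≤ Order.height (F (s i)) := by
    intro j
    induction j with
    | zero =>
      intro i _
      exact hk _ (by rintro _ ⟨x, -, rfl⟩; exact x.2) (hcl (s i))
        ((s i).isIrreducible.image _ continuous_subtype_val.continuousOn)
    | succ j ih =>
      intro i hi
      have hi' : (i : ℕ) + 1 < s.length + 1 := by omega
      have hlt : s i < s ⟨i + 1, hi'⟩ := s.strictMono (Fin.lt_def.2 (Nat.lt_succ_self _))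
      have h1 := ih ⟨i + 1, hi'⟩ (by simp only; omega)
      calc ((k + (j + 1) : ℕ) : ℕ∞) = ((k + j : ℕ) : ℕ∞) + 1 := by push_cast; ring
        _ ≤ Order.height (F (s ⟨i + 1, hi'⟩)) + 1 := by gcongr
        _ ≤ _ := Order.height_add_one_le (hF _ _ hlt)
  have h0 := key s.length 0 (by simp)
  -- The irrelevant ideal extends the chain of primes once more, while the polynomial ring has
  -- dimension `Nat.card σ`.
  let M : PrimeSpectrum (MvPolynomial σ ℂ) :=
    ⟨RingHom.ker (MvPolynomial.eval (0 : σ → ℂ)), RingHom.ker_isPrime _⟩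
  have hM : F (s 0) < M :=
    vanishingIdeal_lt_ker_eval_zero ((s 0).isIrreducible.nonempty.image _)
  have h1 : ((k + s.length + 1 : ℕ) : ℕ∞) ≤ Order.height M := by
    calc ((k + s.length + 1 : ℕ) : ℕ∞) = ((k + s.length : ℕ) : ℕ∞) + 1 := by push_cast; ring
      _ ≤ Order.height (F (s 0)) + 1 := by gcongr
      _ ≤ _ := Order.height_add_one_le hM
  have h2 : (Order.height M : WithBot ℕ∞) ≤ (Nat.card σ : ℕ) := by
    refine (Order.height_le_krullDim M).trans ?_
    have := MvPolynomial.ringKrullDim_of_isNoetherianRing (R := ℂ) (ι := σ)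
    rw [ringKrullDim_eq_zero_of_field, zero_add] at this
    exact this.le
  have h3 : ((k + s.length + 1 : ℕ) : WithBot ℕ∞) ≤ (Nat.card σ : ℕ) :=
    le_trans (by exact_mod_cast h1) h2
  have h4 : k + s.length + 1 ≤ Nat.card σ := by exact_mod_cast h3
  exact_mod_cast (by omega : s.length ≤ d)

/-! ### Hilbert functions -/

theorem finrank_map_eq_of_forall_mem_iff {K V V₁ V₂ : Type*} [Field K] [AddCommGroup V]
    [Module K V] [AddCommGroup V₁] [Module K V₁] [AddCommGroup V₂] [Module K V₂]
    (W : Submodule K V) (f : V →ₗ[K] V₁) (g : V →ₗ[K] V₂)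
    (h : ∀ x ∈ W, f x = 0 ↔ g x = 0) :
    Module.finrank K (W.map f) = Module.finrank K (W.map g) := by
  have hker : LinearMap.ker (f.domRestrict W) = LinearMap.ker (g.domRestrict W) := by
    ext x
    exact h x x.2
  rw [← LinearMap.range_domRestrict, ← LinearMap.range_domRestrict]
  exact (((f.domRestrict W).quotKerEquivRange.symm.trans (Submodule.quotEquivOfEq _ _ hker)).trans
    (g.domRestrict W).quotKerEquivRange).finrank_eq

theorem finrank_map_add_finrank_inf_ker {K V V₁ : Type*} [Field K] [AddCommGroup V]
    [Module K V] [AddCommGroup V₁] [Module K V₁] (W : Submodule K V) [FiniteDimensional K W]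
    (f : V →ₗ[K] V₁) :
    Module.finrank K (W.map f) + Module.finrank K ↥(W ⊓ LinearMap.ker f) =
      Module.finrank K W := by
  have h : W ⊓ LinearMap.ker f = (LinearMap.ker (f.domRestrict W)).map W.subtype := by
    ext x
    simp [LinearMap.mem_ker, and_comm]
  rw [h, ← (Submodule.equivMapOfInjective _ W.injective_subtype _).finrank_eq,
    ← LinearMap.range_domRestrict]
  exact LinearMap.finrank_range_add_finrank_ker _

/-- Allows the Hilbert function to be computed in the target of a parametrization instead of in the
quotient ring: two linear maps with the same kernel on the forms of degree m have images of the same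
dimension. -/
theorem hilbertFunction_eq_finrank_map {X : Set (ProjSpace σ)} {m : ℕ} {V : Type*}
    [AddCommGroup V] [Module ℂ V] (g : MvPolynomial σ ℂ →ₗ[ℂ] V)
    (h : ∀ f : MvPolynomial σ ℂ, f.IsHomogeneous m → (f ∈ vanishingIdeal X ↔ g f = 0)) :
    hilbertFunction X m = Module.finrank ℂ ((MvPolynomial.homogeneousSubmodule σ ℂ m).map g) := by
  refine finrank_map_eq_of_forall_mem_iff _ _ _ fun f hf => ?_
  rw [← h f hf]
  exact Ideal.Quotient.eq_zero_iff_mem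

instance [Finite σ] (n : ℕ) : FiniteDimensional ℂ (MvPolynomial.homogeneousSubmodule σ ℂ n) :=
  Module.Finite.iff_fg.2 (MvPolynomial.homogeneousSubmodule_fg σ ℂ n)

theorem finrank_homogeneousSubmodule [Fintype σ] (n : ℕ) :
    Module.finrank ℂ (MvPolynomial.homogeneousSubmodule σ ℂ n) =
      (Fintype.card σ + n - 1).choose n := by
  classical
  rw [MvPolynomial.homogeneousSubmodule_eq_finsupp_supported,
    (AddMonoidAlgebra.supportedEquivFinsupp _).finrank_eq]
  have : ({d | d.degree = n} : Set (σ →₀ ℕ)) =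
      ((Finset.finsuppAntidiag Finset.univ n : Finset (σ →₀ ℕ)) : Set (σ →₀ ℕ)) := by
    ext d
    simp [Finset.mem_finsuppAntidiag, Finsupp.degree_eq_sum]
  rw [this, Module.finrank_finsupp_self]
  simp [Finset.card_finsuppAntidiag_nat_eq_choose]

/-- Multiplication by q shifts degrees by e, so only the degree m component of r contributes to the
product. -/
theorem exists_isHomogeneous_mul_eq {q r : MvPolynomial σ ℂ} {e m : ℕ} (hq : q.IsHomogeneous e)
    (h : (q * r).IsHomogeneous (m + e)) :
    ∃ r' : MvPolynomial σ ℂ, r'.IsHomogeneous m ∧ q * r' = q * r := by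
  have := DirectSum.coe_decompose_mul_add_of_left_mem
    (MvPolynomial.homogeneousSubmodule σ ℂ) (i := e) (j := m) (b := r) hq
  rw [add_comm, DirectSum.decompose_of_mem_same _ h] at this
  exact ⟨_, (DirectSum.decompose (MvPolynomial.homogeneousSubmodule σ ℂ) r m).2, this.symm⟩

/-- The Hilbert function of a hypersurface. -/
theorem hilbertFunction_add_of_vanishingIdeal_eq_span_singleton [Fintype σ]
    {X : Set (ProjSpace σ)} {q : MvPolynomial σ ℂ} {e : ℕ} (hq : q.IsHomogeneous e) (h0 : q ≠ 0)
    (hX : vanishingIdeal X = Ideal.span {q}) (m : ℕ) :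
    hilbertFunction X (m + e) + (Fintype.card σ + m - 1).choose m =
      (Fintype.card σ + (m + e) - 1).choose (m + e) := by
  set W := MvPolynomial.homogeneousSubmodule σ ℂ (m + e)
  let g := (Ideal.Quotient.mkₐ ℂ (Ideal.span {q})).toLinearMap
  have h1 : hilbertFunction X (m + e) = Module.finrank ℂ (W.map g) := by
    refine hilbertFunction_eq_finrank_map g fun f _ => ?_
    rw [hX]
    exact Ideal.Quotient.eq_zero_iff_mem.symm
  -- The multiples of q among the forms of degree m + e are q times the forms of degree m;
  -- multiplication by q is injective, so rank–nullity gives the formula.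
  have hker : W ⊓ LinearMap.ker g =
      (MvPolynomial.homogeneousSubmodule σ ℂ m).map (LinearMap.mulLeft ℂ q) := by
    ext f
    constructor
    · rintro ⟨hf, hfg⟩
      have hf' : f.IsHomogeneous (m + e) := hf
      obtain ⟨r, rfl⟩ := Ideal.mem_span_singleton.1 (Ideal.Quotient.eq_zero_iff_mem.1 hfg)
      exact exists_isHomogeneous_mul_eq hq hf'
    · rintro ⟨r, hr, rfl⟩
      refine ⟨?_, Ideal.Quotient.eq_zero_iff_mem.2
        (Ideal.mul_mem_right _ _ (Ideal.mem_span_singleton_self q))⟩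
      have : (r * q).IsHomogeneous (m + e) := MvPolynomial.IsHomogeneous.mul hr hq
      rwa [mul_comm] at this
  have h2 : Module.finrank ℂ ↥(W ⊓ LinearMap.ker g) = (Fintype.card σ + m - 1).choose m := by
    rw [hker, ← finrank_homogeneousSubmodule]
    exact (Submodule.equivMapOfInjective _ (fun _ _ h => mul_left_cancel₀ h0 h) _).finrank_eq.symm
  rw [h1, ← h2, ← finrank_homogeneousSubmodule (σ := σ)]
  exact finrank_map_add_finrank_inf_ker W g

end General

/-! ### Coordinates in the case `q = (1, 1)` -/

/-- The lag `(0, 0)`. -/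
def l00 : AutocovIndex q11 := lag 0 0 (by norm_num) (by norm_num) (by norm_num)

/-- The lag `(1, 0)`. -/
def l10 : AutocovIndex q11 := lag 1 0 (by norm_num) (by norm_num) (by norm_num)

/-- The lag `(0, 1)`. -/
def l01 : AutocovIndex q11 := lag 0 1 (by norm_num) (by norm_num) (by norm_num)

/-- The lag `(1, 1)`. -/
def l11 : AutocovIndex q11 := lag 1 1 (by norm_num) (by norm_num) (by norm_num)

/-- The lag `(1, -1)`. -/
def l1m : AutocovIndex q11 := lag 1 (-1) (by norm_num) (by norm_num) (by norm_num)

theorem autocovIndex_cases (t : AutocovIndex q11) :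
    t = l00 ∨ t = l10 ∨ t = l01 ∨ t = l11 ∨ t = l1m := by
  obtain ⟨t, ht⟩ := t
  rw [Finset.mem_filter, Finset.mem_Icc] at ht
  obtain ⟨⟨h1, h2⟩, h3⟩ := ht
  have a0 : -1 ≤ t 0 := by simpa using h1 0
  have a1 : -1 ≤ t 1 := by simpa using h1 1
  have b0 : t 0 ≤ 1 := by simpa using h2 0
  have b1 : t 1 ≤ 1 := by simpa using h2 1
  have c : 0 < t 0 ∨ t 0 = 0 ∧ 0 ≤ t 1 := by
    rcases h3.eq_or_lt with h | ⟨i, hi, hlt⟩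
    · have e : ∀ i, 0 = t i := fun i => congrFun h i
      exact Or.inr ⟨(e 0).symm, (e 1).le⟩
    · fin_cases i
      · exact Or.inl hlt
      · exact Or.inr ⟨(hi 0 (by simp)).symm, (show 0 < t 1 from hlt).le⟩
  have ht : t = ![t 0, t 1] := by
    funext i
    fin_cases i <;> rfl
  simp only [l00, l10, l01, l11, l1m, lag, Subtype.mk.injEq]
  rw [ht]
  simp only [Matrix.vecCons_inj, and_true]
  omega

theorem forall_autocovIndex {p : AutocovIndex q11 → Prop} :
    (∀ t, p t) ↔ p l00 ∧ p l10 ∧ p l01 ∧ p l11 ∧ p l1m := by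
  refine ⟨fun h => ⟨h _, h _, h _, h _, h _⟩, fun ⟨h1, h2, h3, h4, h5⟩ t => ?_⟩
  rcases autocovIndex_cases t with rfl | rfl | rfl | rfl | rfl <;> assumption

theorem lag_ne : l00 ≠ l10 ∧ l00 ≠ l01 ∧ l00 ≠ l11 ∧ l00 ≠ l1m ∧ l10 ≠ l01 ∧ l10 ≠ l11 ∧
    l10 ≠ l1m ∧ l01 ≠ l11 ∧ l01 ≠ l1m ∧ l11 ≠ l1m := by
  simp [l00, l10, l01, l11, l1m, lag]

theorem univ_autocovIndex :
    (Finset.univ : Finset (AutocovIndex q11)) = {l00, l10, l01, l11, l1m} := by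
  ext t
  simpa using autocovIndex_cases t

theorem sum_autocovIndex {M : Type*} [AddCommMonoid M] (f : AutocovIndex q11 → M) :
    ∑ t, f t = f l00 + (f l10 + (f l01 + (f l11 + f l1m))) := by
  obtain ⟨h1, h2, h3, h4, h5, h6, h7, h8, h9, h10⟩ := lag_ne
  rw [univ_autocovIndex, Finset.sum_insert, Finset.sum_insert, Finset.sum_insert,
    Finset.sum_insert, Finset.sum_singleton] <;> simp [*]

theorem card_autocovIndex : Fintype.card (AutocovIndex q11) = 5 := by
  rw [← Finset.card_univ, Finset.card_eq_sum_ones, sum_autocovIndex]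
  rfl

/-- The family with the given values. -/
def coords {A : Type*} (w a b h m : A) (t : AutocovIndex q11) : A :=
  if t = l00 then w else if t = l10 then a else if t = l01 then b else if t = l11 then h else m

section coords

variable {A : Type*} (w a b h m : A)

@[simp] theorem coords_l00 : coords w a b h m l00 = w := by simp [coords]
@[simp] theorem coords_l10 : coords w a b h m l10 = a := by simp [coords, lag_ne.1.symm]
@[simp] theorem coords_l01 : coords w a b h m l01 = b := by
  simp [coords, lag_ne.2.1.symm, lag_ne.2.2.2.2.1.symm]
@[simp] theorem coords_l11 : coords w a b h m l11 = h := by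
  obtain ⟨h1, h2, h3, h4, h5, h6, h7, h8, h9, h10⟩ := lag_ne
  simp [coords, h3.symm, h6.symm, h8.symm]
@[simp] theorem coords_l1m : coords w a b h m l1m = m := by
  obtain ⟨h1, h2, h3, h4, h5, h6, h7, h8, h9, h10⟩ := lag_ne
  simp [coords, h4.symm, h7.symm, h9.symm, h10.symm]

theorem eq_coords (v : AutocovIndex q11 → A) :
    v = coords (v l00) (v l10) (v l01) (v l11) (v l1m) := by
  rw [funext_iff, forall_autocovIndex]
  simp

theorem comp_coords {B : Type*} (f : A → B) :
    (fun t => f (coords w a b h m t)) = coords (f w) (f a) (f b) (f h) (f m) := by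
  rw [funext_iff, forall_autocovIndex]
  simp

end coords

theorem coords_ne_zero_iff {w a b h m : ℂ} :
    coords w a b h m ≠ 0 ↔ ¬ (w = 0 ∧ a = 0 ∧ b = 0 ∧ h = 0 ∧ m = 0) := by
  rw [Ne, funext_iff, forall_autocovIndex]
  simp

theorem g00_eq : g00 = MvPolynomial.X l00 := rfl
theorem g10_eq : g10 = MvPolynomial.X l10 := rfl
theorem g01_eq : g01 = MvPolynomial.X l01 := rfl
theorem g11_eq : g11 = MvPolynomial.X l11 := rfl
theorem g1m_eq : g1m = MvPolynomial.X l1m := rfl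

section hom

variable {A : Type*} [CommRing A] [Algebra ℂ A] (x : AutocovIndex q11 → A)

@[simp] theorem aeval_g00 : MvPolynomial.aeval x g00 = x l00 := MvPolynomial.aeval_X _ _
@[simp] theorem aeval_g10 : MvPolynomial.aeval x g10 = x l10 := MvPolynomial.aeval_X _ _
@[simp] theorem aeval_g01 : MvPolynomial.aeval x g01 = x l01 := MvPolynomial.aeval_X _ _
@[simp] theorem aeval_g11 : MvPolynomial.aeval x g11 = x l11 := MvPolynomial.aeval_X _ _
@[simp] theorem aeval_g1m : MvPolynomial.aeval x g1m = x l1m := MvPolynomial.aeval_X _ _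

end hom

section eval

variable (x : AutocovIndex q11 → ℂ)

@[simp] theorem eval_g00 : MvPolynomial.eval x g00 = x l00 := MvPolynomial.eval_X _
@[simp] theorem eval_g10 : MvPolynomial.eval x g10 = x l10 := MvPolynomial.eval_X _
@[simp] theorem eval_g01 : MvPolynomial.eval x g01 = x l01 := MvPolynomial.eval_X _
@[simp] theorem eval_g11 : MvPolynomial.eval x g11 = x l11 := MvPolynomial.eval_X _
@[simp] theorem eval_g1m : MvPolynomial.eval x g1m = x l1m := MvPolynomial.eval_X _

end eval

theorem isHomogeneous_g00 : g00.IsHomogeneous 1 := MvPolynomial.isHomogeneous_X _ _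
theorem isHomogeneous_g10 : g10.IsHomogeneous 1 := MvPolynomial.isHomogeneous_X _ _
theorem isHomogeneous_g01 : g01.IsHomogeneous 1 := MvPolynomial.isHomogeneous_X _ _
theorem isHomogeneous_g11 : g11.IsHomogeneous 1 := MvPolynomial.isHomogeneous_X _ _
theorem isHomogeneous_g1m : g1m.IsHomogeneous 1 := MvPolynomial.isHomogeneous_X _ _

theorem isHomogeneous_ofNat_mul {σ : Type} {f : MvPolynomial σ ℂ} {n : ℕ}
    (hf : f.IsHomogeneous n) (k : ℕ) [k.AtLeastTwo] :
    (OfNat.ofNat k * f : MvPolynomial σ ℂ).IsHomogeneous n := by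
  have := hf.C_mul (OfNat.ofNat k : ℂ)
  rwa [map_ofNat] at this

theorem isHomogeneous_quartic : quartic.IsHomogeneous 4 := by
  have hw := isHomogeneous_g00
  have ha := isHomogeneous_g10
  have hb := isHomogeneous_g01
  have hh := isHomogeneous_g11
  have hm := isHomogeneous_g1m
  unfold quartic
  refine ((((((((((((?_ : MvPolynomial.IsHomogeneous _ 4).sub ?_).add ?_).add ?_).sub ?_).add
    ?_).sub ?_).sub ?_).sub ?_).add ?_).add ?_).add ?_).sub ?_
  · exact (ha.pow 2).mul (hb.pow 2)
  · exact ((hw.mul ha).mul hb).mul hh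
  · exact (ha.pow 2).mul (hh.pow 2)
  · exact (hb.pow 2).mul (hh.pow 2)
  · exact ((hw.mul ha).mul hb).mul hm
  · exact ((hw.pow 2).mul hh).mul hm
  · exact ((isHomogeneous_ofNat_mul (ha.pow 2) 2).mul hh).mul hm
  · exact ((isHomogeneous_ofNat_mul (hb.pow 2) 2).mul hh).mul hm
  · exact (isHomogeneous_ofNat_mul (hh.pow 3) 4).mul hm
  · exact (ha.pow 2).mul (hm.pow 2)
  · exact (hb.pow 2).mul (hm.pow 2)
  · exact (isHomogeneous_ofNat_mul (hh.pow 2) 8).mul (hm.pow 2)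
  · exact (isHomogeneous_ofNat_mul hh 4).mul (hm.pow 3)

/-! ### The autocovariance map -/

theorem mem_box_iff (i j : ℤ) :
    (![i, j] : Fin 2 → ℤ) ∈ Finset.Icc (0 : Fin 2 → ℤ) (fun i => (q11 i : ℤ)) ↔
      (0 ≤ i ∧ i ≤ 1) ∧ 0 ≤ j ∧ j ≤ 1 := by
  rw [Finset.mem_Icc, Pi.le_def, Pi.le_def]
  simp only [Fin.forall_fin_two]
  simp
  tauto

/-- The index `(i, j)` of a moving average coefficient. -/
def coeffIdx (i j : ℤ) (hi : 0 ≤ i ∧ i ≤ 1) (hj : 0 ≤ j ∧ j ≤ 1) : CoeffIndex q11 :=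
  ⟨![i, j], (mem_box_iff i j).2 ⟨hi, hj⟩⟩

/-- The coefficient index `(0, 0)`. -/
def k00 : CoeffIndex q11 := coeffIdx 0 0 (by norm_num) (by norm_num)

/-- The coefficient index `(1, 0)`. -/
def k10 : CoeffIndex q11 := coeffIdx 1 0 (by norm_num) (by norm_num)

/-- The coefficient index `(0, 1)`. -/
def k01 : CoeffIndex q11 := coeffIdx 0 1 (by norm_num) (by norm_num)

/-- The coefficient index `(1, 1)`. -/
def k11 : CoeffIndex q11 := coeffIdx 1 1 (by norm_num) (by norm_num)

theorem coeffIndex_cases (k : CoeffIndex q11) : k = k00 ∨ k = k10 ∨ k = k01 ∨ k = k11 := by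
  obtain ⟨k, hk⟩ := k
  have e : k = ![k 0, k 1] := by
    funext i
    fin_cases i <;> rfl
  rw [e, mem_box_iff] at hk
  simp only [k00, k10, k01, k11, coeffIdx, Subtype.mk.injEq]
  rw [e]
  simp only [Matrix.vecCons_inj, and_true]
  omega

theorem coeffIdx_ne : k00 ≠ k10 ∧ k00 ≠ k01 ∧ k00 ≠ k11 ∧ k10 ≠ k01 ∧ k10 ≠ k11 ∧ k01 ≠ k11 := by
  simp [k00, k10, k01, k11, coeffIdx]

theorem sum_coeffIndex {M : Type*} [AddCommMonoid M] (f : CoeffIndex q11 → M) :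
    ∑ k, f k = f k00 + (f k10 + (f k01 + f k11)) := by
  have : (Finset.univ : Finset (CoeffIndex q11)) = {k00, k10, k01, k11} := by
    ext k
    simpa using coeffIndex_cases k
  obtain ⟨h1, h2, h3, h4, h5, h6⟩ := coeffIdx_ne
  rw [this, Finset.sum_insert, Finset.sum_insert, Finset.sum_insert, Finset.sum_singleton] <;>
    simp [*]

theorem exists_coeff (x y z w : ℂ) :
    ∃ a : CoeffIndex q11 → ℂ, a k00 = x ∧ a k10 = y ∧ a k01 = z ∧ a k11 = w := by
  obtain ⟨h1, h2, h3, h4, h5, h6⟩ := coeffIdx_ne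
  refine ⟨fun k => if k = k00 then x else if k = k10 then y else if k = k01 then z else w, ?_⟩
  simp [h1.symm, h2.symm, h3.symm, h4.symm, h5.symm, h6.symm]

theorem coeffExt_eq_zero (a : CoeffIndex q11 → ℂ) {i j : ℤ}
    (h : ¬((0 ≤ i ∧ i ≤ 1) ∧ 0 ≤ j ∧ j ≤ 1)) : coeffExt q11 a ![i, j] = 0 :=
  dif_neg (mt (mem_box_iff i j).1 h)

theorem coeffExt_eq (a : CoeffIndex q11 → ℂ) {i j : ℤ} (hi : 0 ≤ i ∧ i ≤ 1)
    (hj : 0 ≤ j ∧ j ≤ 1) : coeffExt q11 a ![i, j] = a (coeffIdx i j hi hj) :=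
  dif_pos ((mem_box_iff i j).2 ⟨hi, hj⟩)

theorem autocovMap_eq (a : CoeffIndex q11 → ℂ) :
    autocovMap q11 a = coords (a k00 ^ 2 + a k10 ^ 2 + a k01 ^ 2 + a k11 ^ 2)
      (a k00 * a k10 + a k01 * a k11) (a k00 * a k01 + a k10 * a k11) (a k00 * a k11)
      (a k10 * a k01) := by
  have e00 : coeffExt q11 a ![0, 0] = a k00 := coeffExt_eq a _ _
  have e10 : coeffExt q11 a ![1, 0] = a k10 := coeffExt_eq a _ _
  have e01 : coeffExt q11 a ![0, 1] = a k01 := coeffExt_eq a _ _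
  have e11 : coeffExt q11 a ![1, 1] = a k11 := coeffExt_eq a _ _
  rw [funext_iff, forall_autocovIndex]
  simp only [autocovMap, sum_coeffIndex, coords_l00, coords_l10, coords_l01, coords_l11,
    coords_l1m]
  have v00 : k00.1 = ![0, 0] := rfl
  have v10 : k10.1 = ![1, 0] := rfl
  have v01 : k01.1 = ![0, 1] := rfl
  have v11 : k11.1 = ![1, 1] := rfl
  have w00 : l00.1 = ![0, 0] := rfl
  have w10 : l10.1 = ![1, 0] := rfl
  have w01 : l01.1 = ![0, 1] := rfl
  have w11 : l11.1 = ![1, 1] := rfl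
  have w1m : l1m.1 = ![1, -1] := rfl
  -- Among the shifted indices k + t that leave the box, some coordinate is 2 or the second
  -- coordinate is -1.
  have ho : ∀ i j : ℤ, i = 2 ∨ j = 2 ∨ j = -1 → coeffExt q11 a ![i, j] = 0 := fun i j h =>
    coeffExt_eq_zero a (by omega)
  simp only [v00, v10, v01, v11, w00, w10, w01, w11, w1m, Matrix.cons_add_cons,
    Matrix.empty_add_empty, add_zero, zero_add, one_add_one_eq_two, add_neg_cancel, e00, e10, e01,
    e11, ho, true_or, or_true, mul_zero]
  exact ⟨by ring, trivial, trivial, trivial, by ring⟩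

/-! ### Irreducibility criteria -/

section Irreducible

open Polynomial

variable {B : Type*} [CommRing B] [IsDomain B]

/-- Gauss's argument: a constant factor divides all coefficients and is a unit, while a
factorization (aX + b)(cX + d) makes the discriminant equal to (ad - bc)². With α = 0 only the
condition on the coefficients matters, which covers the linear polynomial arising from `P3`. -/
theorem irreducible_quadratic {α β γ : B} (h0 : α ≠ 0 ∨ β ≠ 0)
    (hprim : ∀ d, d ∣ α → d ∣ β → d ∣ γ → IsUnit d)
    (hdisc : α ≠ 0 → ∀ r, r ^ 2 ≠ β ^ 2 - 4 * α * γ) :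
    Irreducible (C α * X ^ 2 + C β * X + C γ) := by
  have coeffs : ∀ a b c : B, (C a * X ^ 2 + C b * X + C c).coeff 2 = a ∧
      (C a * X ^ 2 + C b * X + C c).coeff 1 = b ∧ (C a * X ^ 2 + C b * X + C c).coeff 0 = c := by
    intro a b c
    simp [coeff_X, coeff_C, coeff_X_pow]
  obtain ⟨p2, p1, p0⟩ := coeffs α β γ
  set p : B[X] := C α * X ^ 2 + C β * X + C γ with hp
  have hle : p.natDegree ≤ 2 := natDegree_quadratic_le
  have h1 : p.natDegree ≠ 0 := by
    intro h
    have hc : ∀ n, n ≠ 0 → p.coeff n = 0 := fun n hn =>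
      coeff_eq_zero_of_natDegree_lt (by omega)
    rcases h0 with h0 | h0
    · exact h0 (p2 ▸ hc 2 (by norm_num))
    · exact h0 (p1 ▸ hc 1 (by norm_num))
  have hp0 : p ≠ 0 := fun h => h1 (by rw [h, natDegree_zero])
  have hconst : ∀ f g : B[X], p = f * g → f.natDegree = 0 → IsUnit f := by
    intro f g hfg hf
    rw [eq_C_of_natDegree_eq_zero hf] at hfg ⊢
    have hdvd : ∀ n, f.coeff 0 ∣ p.coeff n := by
      intro n
      rw [hfg, coeff_C_mul]
      exact dvd_mul_right _ _
    exact isUnit_C.2 (hprim _ (p2 ▸ hdvd 2) (p1 ▸ hdvd 1) (p0 ▸ hdvd 0))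
  refine ⟨fun h => h1 (natDegree_eq_zero_of_isUnit h), fun f g hfg => ?_⟩
  have hf0 : f ≠ 0 := fun h => hp0 (by rw [hfg, h, zero_mul])
  have hg0 : g ≠ 0 := fun h => hp0 (by rw [hfg, h, mul_zero])
  have hdeg : p.natDegree = f.natDegree + g.natDegree := by rw [hfg, natDegree_mul hf0 hg0]
  by_cases hf : f.natDegree = 0
  · exact Or.inl (hconst f g hfg hf)
  by_cases hg : g.natDegree = 0
  · exact Or.inr (hconst g f (by rw [hfg, mul_comm]) hg)
  have ef := eq_X_add_C_of_natDegree_le_one (p := f) (by omega)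
  have eg := eq_X_add_C_of_natDegree_le_one (p := g) (by omega)
  have h2 : p.natDegree = 2 := by omega
  have hα : α ≠ 0 := by
    rw [← p2, ← h2]
    exact leadingCoeff_ne_zero.2 hp0
  generalize f.coeff 1 = a, f.coeff 0 = b at ef
  generalize g.coeff 1 = c, g.coeff 0 = d at eg
  have e : p = C (a * c) * X ^ 2 + C (a * d + b * c) * X + C (b * d) := by
    rw [hfg, ef, eg]
    simp only [C_mul, C_add]
    ring
  obtain ⟨c2, c1, c0⟩ := coeffs (a * c) (a * d + b * c) (b * d)
  rw [← e] at c2 c1 c0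
  refine (hdisc hα (a * d - b * c) ?_).elim
  rw [← p2, ← p1, ← p0, c2, c1, c0]
  ring

/-- Every root of a square is multiple, so one simple root rules out a square. -/
theorem sq_ne_of_derivative_ne_zero {K : Type*} [CommRing K] [IsDomain K] {D : K[X]} {t : K}
    (h0 : D.eval t = 0) (h1 : (derivative D).eval t ≠ 0) (r : K[X]) : r ^ 2 ≠ D := by
  rintro rfl
  rw [eval_pow, sq_eq_zero_iff] at h0
  apply h1
  rw [derivative_pow, eval_mul, eval_mul]
  simp [h0]

end Irreducible

/-- Modulo I the composite of e and ι is the identity, so I is the preimage under e of the prime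
ideal generated by q. This eliminates variables by linear generators and singles out one variable in
which the remaining generator is at most quadratic. -/
theorem isPrime_of_retraction {R S : Type*} [CommRing R] [CommRing S] {I : Ideal R} (e : R →+* S)
    (ι : S →+* R) {q : S} (hq : Prime q) (h1 : ∀ f, f - ι (e f) ∈ I) (h2 : ∀ f ∈ I, q ∣ e f)
    (h3 : ι q ∈ I) : I.IsPrime := by
  have h : I = (Ideal.span {q}).comap e := by
    ext f
    rw [Ideal.mem_comap, Ideal.mem_span_singleton]
    refine ⟨h2 f, fun ⟨s, hs⟩ => ?_⟩
    have := h1 f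
    rw [hs, map_mul] at this
    exact (Submodule.sub_mem_iff_left I (Ideal.mul_mem_right _ _ h3)).1 this
  have := (Ideal.span_singleton_prime hq.ne_zero).2 hq
  rw [h]
  exact Ideal.comap_isPrime _ _

theorem sub_mem_of_forall_X {σ A : Type*} [CommRing A] {I : Ideal (MvPolynomial σ A)}
    (u : MvPolynomial σ A →+* MvPolynomial σ A)
    (hC : ∀ c, u (MvPolynomial.C c) = MvPolynomial.C c)
    (hX : ∀ t, MvPolynomial.X t - u (MvPolynomial.X t) ∈ I) (f : MvPolynomial σ A) :
    f - u f ∈ I := by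
  have : (Ideal.Quotient.mk I).comp u = Ideal.Quotient.mk I := by
    apply MvPolynomial.ringHom_ext
    · intro c
      rw [RingHom.comp_apply, hC]
    · intro t
      exact ((Ideal.Quotient.mk_eq_mk_iff_sub_mem _ _).2 (hX t)).symm
  exact (Ideal.Quotient.mk_eq_mk_iff_sub_mem _ _).1 (RingHom.congr_fun this f).symm

/-- A nonunit has an irreducible factor, which must be associated to one of the two variables. -/
theorem X_dvd_or_isUnit {n : ℕ} {d : MvPolynomial (Fin n) ℂ} {i j : Fin n}
    (hd : d ∣ MvPolynomial.X i * MvPolynomial.X j) :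
    IsUnit d ∨ MvPolynomial.X i ∣ d ∨ MvPolynomial.X j ∣ d := by
  by_contra! h
  obtain ⟨hu, hi, hj⟩ := h
  have hd0 : d ≠ 0 := fun h => hi (h ▸ dvd_zero _)
  obtain ⟨π, hπ, hπd⟩ := WfDvdMonoid.exists_irreducible_factor hu hd0
  rcases hπ.prime.dvd_or_dvd (hπd.trans hd) with h | h
  · exact hi (((hπ.dvd_irreducible_iff_associated
      (MvPolynomial.X_prime).irreducible).1 h).symm.dvd.trans hπd)
  · exact hj (((hπ.dvd_irreducible_iff_associated
      (MvPolynomial.X_prime).irreducible).1 h).symm.dvd.trans hπd)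

theorem not_X_dvd {n : ℕ} {p : MvPolynomial (Fin n) ℂ} {i : Fin n} (x : Fin n → ℂ) (hx : x i = 0)
    (hp : MvPolynomial.eval x p ≠ 0) : ¬ MvPolynomial.X i ∣ p := by
  rintro ⟨q, rfl⟩
  simp [hx] at hp

/-! ### The four prime ideals -/

section Prime

open Polynomial

/-- This is the quartic as a polynomial in g00 over the ring in g10, g01, g11, g1m. It is primitive
because neither variable of the leading coefficient divides the constant term. -/
theorem prime_quadratic_of_quartic :
    Prime (C (MvPolynomial.X 2 * MvPolynomial.X 3) * X ^ 2 +
      C (-(MvPolynomial.X 0 * MvPolynomial.X 1 * (MvPolynomial.X 2 + MvPolynomial.X 3))) * X +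
      C ((MvPolynomial.X 0 * MvPolynomial.X 1) ^ 2 + (MvPolynomial.X 3 - MvPolynomial.X 2) ^ 2 *
        (MvPolynomial.X 0 ^ 2 + MvPolynomial.X 1 ^ 2 -
          4 * (MvPolynomial.X 2 * MvPolynomial.X 3))) : (MvPolynomial (Fin 4) ℂ)[X]) := by
  have h0 : (MvPolynomial.X 2 * MvPolynomial.X 3 : MvPolynomial (Fin 4) ℂ) ≠ 0 :=
    mul_ne_zero (MvPolynomial.X_ne_zero _) (MvPolynomial.X_ne_zero _)
  refine (irreducible_quadratic (Or.inl h0) ?_ ?_).prime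
  · intro d d2 _ d0
    rcases X_dvd_or_isUnit d2 with h | h | h
    · exact h
    · refine (not_X_dvd ![1, 1, 0, 1] rfl ?_ (h.trans d0)).elim
      simp
      norm_num
    · refine (not_X_dvd ![1, 1, 1, 0] rfl ?_ (h.trans d0)).elim
      simp
      norm_num
  · intro _ r hr
    -- Under this specialization the discriminant becomes (25/16)(X² + 1), which has the simple root
    -- `Complex.I`.
    let ev : MvPolynomial (Fin 4) ℂ →ₐ[ℂ] ℂ[X] := MvPolynomial.aeval ![X, 0, 1, C (-1 / 4)]
    have h := congrArg ev hr
    rw [map_pow] at h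
    refine sq_ne_of_derivative_ne_zero (t := Complex.I) ?_ ?_ (ev r) h
    · simp [ev]
      norm_num
    · simp [ev]
      norm_num

theorem isPrime_span_quartic : (Ideal.span {quartic}).IsPrime := by
  let e : CoordRing →ₐ[ℂ] (MvPolynomial (Fin 4) ℂ)[X] := MvPolynomial.aeval
    (coords X (C (MvPolynomial.X 0)) (C (MvPolynomial.X 1)) (C (MvPolynomial.X 2))
      (C (MvPolynomial.X 3)))
  let ι : (MvPolynomial (Fin 4) ℂ)[X] →+* CoordRing :=
    eval₂RingHom (MvPolynomial.aeval (R := ℂ) ![g10, g01, g11, g1m]).toRingHom g00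
  refine isPrime_of_retraction e.toRingHom ι prime_quadratic_of_quartic
    (sub_mem_of_forall_X (ι.comp e.toRingHom) ?_ ?_) ?_ ?_
  · intro c
    simp [e, ι]
  · rw [forall_autocovIndex]
    simp [e, ι, g00_eq, g10_eq, g01_eq, g11_eq, g1m_eq]
  · intro f hf
    obtain ⟨r, rfl⟩ := Ideal.mem_span_singleton.1 hf
    refine Dvd.dvd.trans (dvd_of_eq ?_) (Dvd.intro _ (map_mul e quartic r).symm)
    simp only [e, quartic, map_mul, map_add, map_sub,
      map_neg, map_pow, map_ofNat, aeval_g00, aeval_g10, aeval_g01, aeval_g11, aeval_g1m,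
      coords_l00, coords_l10, coords_l01, coords_l11, coords_l1m]
    ring
  · have hX : ι X = g00 := by simp [ι]
    have h0 : ι (C (MvPolynomial.X 0)) = g10 := by simp [ι]
    have h1 : ι (C (MvPolynomial.X 1)) = g01 := by simp [ι]
    have h2 : ι (C (MvPolynomial.X 2)) = g11 := by simp [ι]
    have h3 : ι (C (MvPolynomial.X 3)) = g1m := by simp [ι]
    refine Ideal.mem_span_singleton.2 (dvd_of_eq ?_)
    simp only [map_mul, map_add, map_sub, map_neg, map_pow, map_ofNat, hX, h0, h1, h2, h3, quartic]
    ring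

theorem prime_quadratic_of_conic :
    Prime (C (-1) * X ^ 2 + C 0 * X + C (4 * (MvPolynomial.X 0 * MvPolynomial.X 1)) :
      (MvPolynomial (Fin 2) ℂ)[X]) := by
  refine (irreducible_quadratic (Or.inl (neg_ne_zero.2 one_ne_zero)) ?_ ?_).prime
  · intro d hd _ _
    exact isUnit_of_dvd_unit hd isUnit_one.neg
  · intro _ r hr
    -- The discriminant is 16 times the product of the two variables and specializes to 16X, with
    -- simple root 0.
    let ev : MvPolynomial (Fin 2) ℂ →ₐ[ℂ] ℂ[X] := MvPolynomial.aeval ![X, 1]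
    have h := congrArg ev hr
    rw [map_pow] at h
    refine sq_ne_of_derivative_ne_zero (t := 0) ?_ ?_ (ev r) h
    · simp [ev]
    · simp [ev]

/-- The two linear generators eliminate g00 and g10; what remains is the equation of a smooth conic,
quadratic in g01 over the polynomial ring in g11 and g1m. -/
theorem isPrime_P1 : P1.IsPrime := by
  let e : CoordRing →ₐ[ℂ] (MvPolynomial (Fin 2) ℂ)[X] := MvPolynomial.aeval
    (coords ((2 * C (MvPolynomial.X 0) + 2 * C (MvPolynomial.X 1))) (X) X
      (C (MvPolynomial.X 0)) (C (MvPolynomial.X 1)))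
  let ι : (MvPolynomial (Fin 2) ℂ)[X] →+* CoordRing :=
    eval₂RingHom (MvPolynomial.aeval (R := ℂ) ![g11, g1m]).toRingHom g01
  have m1 : g10 - g01 ∈ P1 := Ideal.subset_span (by simp)
  have m2 : g00 - 2 * g11 - 2 * g1m ∈ P1 := Ideal.subset_span (by simp)
  have m3 : 4 * g11 * g1m - g01 ^ 2 ∈ P1 := Ideal.subset_span (by simp)
  have hX : ι X = g01 := by simp [ι]
  have h0 : ι (C (MvPolynomial.X 0)) = g11 := by simp [ι]
  have h1 : ι (C (MvPolynomial.X 1)) = g1m := by simp [ι]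
  refine isPrime_of_retraction e.toRingHom ι prime_quadratic_of_conic
    (sub_mem_of_forall_X (ι.comp e.toRingHom) ?_ ?_) ?_ ?_
  · intro c
    simp [e, ι]
  · rw [forall_autocovIndex]
    simp only [← g00_eq, ← g10_eq, ← g01_eq, ← g11_eq, ← g1m_eq, RingHom.comp_apply,
      AlgHom.toRingHom_eq_coe, RingHom.coe_coe, e, aeval_g00, aeval_g10, aeval_g01, aeval_g11,
      aeval_g1m, coords_l00, coords_l10, coords_l01, coords_l11, coords_l1m, map_add, map_mul,
      map_ofNat, hX, h0, h1, sub_self, zero_mem, and_true]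
    exact ⟨by convert m2 using 1; ring, by convert m1 using 1⟩
  · suffices P1 ≤ (Ideal.span {C (-1) * X ^ 2 + C 0 * X +
        C (4 * (MvPolynomial.X 0 * MvPolynomial.X 1))}).comap e.toRingHom from
      fun f hf => Ideal.mem_span_singleton.1 (this hf)
    refine Ideal.span_le.2 ?_
    rintro f (rfl | rfl | rfl) <;>
    refine Ideal.mem_span_singleton.2 ?_ <;>
    simp only [AlgHom.toRingHom_eq_coe, RingHom.coe_coe, e, map_mul, map_sub, map_neg,
      map_pow, map_ofNat, aeval_g00, aeval_g10, aeval_g01, aeval_g11, aeval_g1m, coords_l00,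
      coords_l10, coords_l01, coords_l11, coords_l1m, map_one, map_zero]
    · exact Dvd.intro 0 (by ring)
    · exact Dvd.intro 0 (by ring)
    · exact Dvd.intro 1 (by ring)
  · convert m3 using 1
    simp only [map_mul, map_add, map_neg, map_pow, map_ofNat, map_one, map_zero, hX, h0, h1]
    ring

theorem isPrime_P2 : P2.IsPrime := by
  let e : CoordRing →ₐ[ℂ] (MvPolynomial (Fin 2) ℂ)[X] := MvPolynomial.aeval
    (coords (-(2 * C (MvPolynomial.X 0) + 2 * C (MvPolynomial.X 1))) (-X) X
      (C (MvPolynomial.X 0)) (C (MvPolynomial.X 1)))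
  let ι : (MvPolynomial (Fin 2) ℂ)[X] →+* CoordRing :=
    eval₂RingHom (MvPolynomial.aeval (R := ℂ) ![g11, g1m]).toRingHom g01
  have m1 : g10 + g01 ∈ P2 := Ideal.subset_span (by simp)
  have m2 : g00 + 2 * g11 + 2 * g1m ∈ P2 := Ideal.subset_span (by simp)
  have m3 : 4 * g11 * g1m - g01 ^ 2 ∈ P2 := Ideal.subset_span (by simp)
  have hX : ι X = g01 := by simp [ι]
  have h0 : ι (C (MvPolynomial.X 0)) = g11 := by simp [ι]
  have h1 : ι (C (MvPolynomial.X 1)) = g1m := by simp [ι]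
  refine isPrime_of_retraction e.toRingHom ι prime_quadratic_of_conic
    (sub_mem_of_forall_X (ι.comp e.toRingHom) ?_ ?_) ?_ ?_
  · intro c
    simp [e, ι]
  · rw [forall_autocovIndex]
    simp only [← g00_eq, ← g10_eq, ← g01_eq, ← g11_eq, ← g1m_eq, RingHom.comp_apply,
      AlgHom.toRingHom_eq_coe, RingHom.coe_coe, e, aeval_g00, aeval_g10, aeval_g01, aeval_g11,
      aeval_g1m, coords_l00, coords_l10, coords_l01, coords_l11, coords_l1m, map_add, map_mul,
      map_neg, map_ofNat, hX, h0, h1, sub_self, zero_mem, and_true]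
    exact ⟨by convert m2 using 1; ring, by convert m1 using 1; ring⟩
  · suffices P2 ≤ (Ideal.span {C (-1) * X ^ 2 + C 0 * X +
        C (4 * (MvPolynomial.X 0 * MvPolynomial.X 1))}).comap e.toRingHom from
      fun f hf => Ideal.mem_span_singleton.1 (this hf)
    refine Ideal.span_le.2 ?_
    rintro f (rfl | rfl | rfl) <;>
    refine Ideal.mem_span_singleton.2 ?_ <;>
    simp only [AlgHom.toRingHom_eq_coe, RingHom.coe_coe, e, map_mul, map_add, map_sub, map_neg,
      map_pow, map_ofNat, aeval_g00, aeval_g10, aeval_g01, aeval_g11, aeval_g1m, coords_l00,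
      coords_l10, coords_l01, coords_l11, coords_l1m, map_one, map_zero]
    · exact Dvd.intro 0 (by ring)
    · exact Dvd.intro 0 (by ring)
    · exact Dvd.intro 1 (by ring)
  · convert m3 using 1
    simp only [map_mul, map_add, map_neg, map_pow, map_ofNat, map_one, map_zero, hX, h0, h1]
    ring

theorem prime_linear_of_quadric :
    Prime (C 0 * X ^ 2 + C (MvPolynomial.X 2) * X + C (-(MvPolynomial.X 0 * MvPolynomial.X 1)) :
      (MvPolynomial (Fin 3) ℂ)[X]) := by
  refine (irreducible_quadratic (Or.inr (MvPolynomial.X_ne_zero _)) ?_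
    fun h => (h rfl).elim).prime
  intro d _ d1 d0
  -- A divisor of the single variable also divides its square, which has the shape of a product of
  -- two variables.
  rcases X_dvd_or_isUnit (d1.mul_right (MvPolynomial.X 2)) with h | h | h
  · exact h
  all_goals
    refine (not_X_dvd ![1, 1, 0] rfl ?_ (h.trans d0)).elim
    simp

/-- Identifying g1m with g11 leaves a quadric that is linear and primitive in g00. -/
theorem isPrime_P3 : P3.IsPrime := by
  let e : CoordRing →ₐ[ℂ] (MvPolynomial (Fin 3) ℂ)[X] := MvPolynomial.aeval
    (coords X (C (MvPolynomial.X 0)) (C (MvPolynomial.X 1)) (C (MvPolynomial.X 2))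
      (C (MvPolynomial.X 2)))
  let ι : (MvPolynomial (Fin 3) ℂ)[X] →+* CoordRing :=
    eval₂RingHom (MvPolynomial.aeval (R := ℂ) ![g10, g01, g11]).toRingHom g00
  have m1 : g11 - g1m ∈ P3 := Ideal.subset_span (by simp)
  have m2 : g00 * g1m - g10 * g01 ∈ P3 := Ideal.subset_span (by simp)
  have hX : ι X = g00 := by simp [ι]
  have h0 : ι (C (MvPolynomial.X 0)) = g10 := by simp [ι]
  have h1 : ι (C (MvPolynomial.X 1)) = g01 := by simp [ι]
  have h2 : ι (C (MvPolynomial.X 2)) = g11 := by simp [ι]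
  refine isPrime_of_retraction e.toRingHom ι prime_linear_of_quadric
    (sub_mem_of_forall_X (ι.comp e.toRingHom) ?_ ?_) ?_ ?_
  · intro c
    simp [e, ι]
  · rw [forall_autocovIndex]
    simp only [← g00_eq, ← g10_eq, ← g01_eq, ← g11_eq, ← g1m_eq, RingHom.comp_apply,
      AlgHom.toRingHom_eq_coe, RingHom.coe_coe, e, aeval_g00, aeval_g10, aeval_g01, aeval_g11,
      aeval_g1m, coords_l00, coords_l10, coords_l01, coords_l11, coords_l1m, hX, h0, h1, h2,
      sub_self, zero_mem, true_and]
    rw [← neg_sub]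
    exact neg_mem m1
  · suffices P3 ≤ (Ideal.span {C 0 * X ^ 2 + C (MvPolynomial.X 2) * X +
        C (-(MvPolynomial.X 0 * MvPolynomial.X 1))}).comap e.toRingHom from
      fun f hf => Ideal.mem_span_singleton.1 (this hf)
    refine Ideal.span_le.2 ?_
    rintro f (rfl | rfl) <;>
    refine Ideal.mem_span_singleton.2 ?_ <;>
    simp only [AlgHom.toRingHom_eq_coe, RingHom.coe_coe, e, map_mul, map_sub, map_neg, aeval_g00,
      aeval_g10, aeval_g01, aeval_g11, aeval_g1m, coords_l00, coords_l10, coords_l01, coords_l11,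
      coords_l1m, map_zero]
    · exact Dvd.intro 0 (by ring)
    · exact Dvd.intro 1 (by ring)
  · have : ι (C 0 * X ^ 2 + C (MvPolynomial.X 2) * X +
        C (-(MvPolynomial.X 0 * MvPolynomial.X 1))) =
        (g00 * g1m - g10 * g01) + g00 * (g11 - g1m) := by
      simp only [map_mul, map_add, map_neg, map_pow, map_zero, hX, h0, h1, h2]
      ring
    rw [this]
    exact add_mem m2 (Ideal.mul_mem_left _ _ m1)

end Prime

/-! ### Tangent spaces and singular points of hypersurfaces -/

section General

variable {σ : Type}

theorem zeroLocus_span {S : Set (MvPolynomial σ ℂ)} (hS : ∀ f ∈ S, ∃ n : ℕ, f.IsHomogeneous n) :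
    zeroLocus (Ideal.span S : Set (MvPolynomial σ ℂ)) = zeroLocus S := by
  ext p
  obtain ⟨v, hv, rfl⟩ := exists_eq_point p
  rw [point_mem_zeroLocus_span_iff hS, point_mem_zeroLocus_iff]
  refine forall₂_congr fun f hf => ⟨fun h _ _ => h, fun h => ?_⟩
  obtain ⟨n, hn⟩ := hS f hf
  exact h n hn

/-- The tangent space of a hypersurface is the kernel of the gradient. -/
theorem mem_tangentSpace_iff [Fintype σ] {X : Set (ProjSpace σ)} {q : MvPolynomial σ ℂ}
    (hX : vanishingIdeal X = Ideal.span {q}) {p : ProjSpace σ} (hp : p ∈ X) (v : σ → ℂ) :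
    v ∈ tangentSpace X p ↔
      ∑ i, MvPolynomial.eval (Projectivization.rep p) (MvPolynomial.pderiv i q) * v i = 0 := by
  have hq : q ∈ vanishingIdeal X := hX ▸ Ideal.mem_span_singleton_self q
  have h0 := eval_rep_eq_zero_of_mem_vanishingIdeal hq hp
  refine ⟨fun h => h q hq, fun h f hf => ?_⟩
  rw [hX] at hf
  obtain ⟨r, rfl⟩ := Ideal.mem_span_singleton.1 hf
  have : ∀ i, MvPolynomial.eval (Projectivization.rep p) (MvPolynomial.pderiv i (q * r)) * v i =
      MvPolynomial.eval (Projectivization.rep p) r *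
        (MvPolynomial.eval (Projectivization.rep p) (MvPolynomial.pderiv i q) * v i) := by
    intro i
    rw [MvPolynomial.pderiv_mul, map_add, map_mul, map_mul, h0]
    ring
  rw [Finset.sum_congr rfl fun i _ => this i, ← Finset.mul_sum, h, mul_zero]

theorem finrank_tangentSpace_eq_card_iff [Fintype σ] {X : Set (ProjSpace σ)}
    {q : MvPolynomial σ ℂ} (hX : vanishingIdeal X = Ideal.span {q}) {p : ProjSpace σ}
    (hp : p ∈ X) :
    Module.finrank ℂ (tangentSpace X p) = Fintype.card σ ↔
      ∀ i, MvPolynomial.eval (Projectivization.rep p) (MvPolynomial.pderiv i q) = 0 := by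
  classical
  rw [← Module.finrank_fintype_fun_eq_card ℂ]
  constructor
  · intro h i
    have h1 : Pi.single i 1 ∈ tangentSpace X p := by
      rw [Submodule.eq_top_of_finrank_eq h]
      trivial
    rw [mem_tangentSpace_iff hX hp] at h1
    simpa [Pi.single_apply] using h1
  · intro h
    have : tangentSpace X p = ⊤ := by
      refine (Submodule.eq_top_iff').2 fun v => (mem_tangentSpace_iff hX hp v).2 ?_
      simp [h]
    rw [this, finrank_top]

/-- The affine cone has dimension d + 1, one less than the ambient space, so the tangent space is
too large exactly when it is everything, that is, when the gradient vanishes. -/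
theorem singularLocus_eq [Fintype σ] {X : Set (ProjSpace σ)} {q : MvPolynomial σ ℂ}
    (hX : vanishingIdeal X = Ideal.span {q}) {d : ℕ} (hd : topologicalKrullDim X = d)
    (hcard : Fintype.card σ = d + 2) :
    singularLocus X = {p | p ∈ X ∧
      ∀ i, MvPolynomial.eval (Projectivization.rep p) (MvPolynomial.pderiv i q) = 0} := by
  ext p
  refine and_congr_right fun hp => ?_
  rw [← finrank_tangentSpace_eq_card_iff hX hp, hd, hcard]
  have hle : Module.finrank ℂ (tangentSpace X p) ≤ d + 2 := by
    rw [← hcard, ← Module.finrank_fintype_fun_eq_card ℂ]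
    exact Submodule.finrank_le _
  have : ((d : WithBot ℕ∞) + 1 < (Module.finrank ℂ (tangentSpace X p) : WithBot ℕ∞)) ↔
      d + 1 < Module.finrank ℂ (tangentSpace X p) := by
    exact_mod_cast Iff.rfl
  rw [this]
  omega

end General

/-! ### The variety is the quartic hypersurface -/

/-- The grouping produced by elimination, used instead of the expanded form from here on; it shows
that the quartic becomes a square on g11 = g1m. -/
theorem eval_quartic (v : AutocovIndex q11 → ℂ) :
    MvPolynomial.eval v quartic =
      (v l10 * v l01 - v l00 * v l11) * (v l10 * v l01 - v l00 * v l1m) -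
        (v l1m - v l11) ^ 2 * (4 * v l11 * v l1m - v l10 ^ 2 - v l01 ^ 2) := by
  simp only [quartic, map_add, map_sub, map_mul, map_pow, map_ofNat, eval_g00, eval_g10, eval_g01,
    eval_g11, eval_g1m]
  ring

theorem quartic_ne_zero : quartic ≠ 0 := by
  intro h
  have := eval_quartic (coords 0 1 1 0 0)
  simp [h] at this

theorem point_mem_zeroLocus_quartic_iff {v : AutocovIndex q11 → ℂ} (h : v ≠ 0) :
    point v h ∈ zeroLocus {quartic} ↔ MvPolynomial.eval v quartic = 0 := by
  rw [point_mem_zeroLocus_iff]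
  refine ⟨fun H => H _ rfl 4 isHomogeneous_quartic, ?_⟩
  rintro H _ rfl _ _
  exact H

/-- Arbitrary square roots of A and B have product s or -s; changing the sign of one of them
corrects this. -/
theorem exists_sq_mul_eq {A B s : ℂ} (h : A * B = s ^ 2) :
    ∃ S P : ℂ, S ^ 2 = A ∧ P ^ 2 = B ∧ S * P = s := by
  obtain ⟨S, hS⟩ := IsAlgClosed.exists_pow_nat_eq A (n := 2) (by norm_num)
  obtain ⟨P, hP⟩ := IsAlgClosed.exists_pow_nat_eq B (n := 2) (by norm_num)
  have : (S * P - s) * (S * P + s) = 0 := by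
    linear_combination P ^ 2 * hS + A * hP + h
  rcases mul_eq_zero.1 this with h1 | h1
  · exact ⟨S, P, hS, hP, by linear_combination h1⟩
  · exact ⟨S, -P, hS, by rw [neg_sq, hP], by linear_combination -h1⟩

/-- Here c and d play the roles of u² + v² and x² + y². The hypotheses amount to c + d = w together
with (c ± 2h)(d ± 2m) = (a ± b)², so square roots with products a + b and a - b exist. -/
theorem exists_autocov_of_sum_of_mul {w a b h m c d : ℂ} (h1 : c + d = w)
    (h2 : c * d = a ^ 2 + b ^ 2 - 4 * h * m) (h3 : c * m + d * h = a * b) :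
    ∃ u x y v : ℂ, u ^ 2 + x ^ 2 + y ^ 2 + v ^ 2 = w ∧ u * x + y * v = a ∧ u * y + x * v = b ∧
      u * v = h ∧ x * y = m := by
  obtain ⟨S, P, hS, hP, hSP⟩ := exists_sq_mul_eq (A := c + 2 * h) (B := d + 2 * m) (s := a + b)
    (by linear_combination h2 + 2 * h3)
  obtain ⟨D, E, hD, hE, hDE⟩ := exists_sq_mul_eq (A := c - 2 * h) (B := d - 2 * m) (s := a - b)
    (by linear_combination h2 - 2 * h3)
  -- S, D, P, E stand for u + v, u - v, x + y, x - y.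
  refine ⟨(S + D) / 2, (P + E) / 2, (P - E) / 2, (S - D) / 2, ?_, ?_, ?_, ?_, ?_⟩
  · linear_combination (hS + hP + hD + hE) / 2 + h1
  · linear_combination (hSP + hDE) / 2
  · linear_combination (hSP - hDE) / 2
  · linear_combination (hS - hD) / 4
  · linear_combination (hP - hE) / 4

theorem exists_autocov {w a b h m : ℂ}
    (hq : (a * b - w * h) * (a * b - w * m) - (m - h) ^ 2 * (4 * h * m - a ^ 2 - b ^ 2) = 0) :
    ∃ u x y v : ℂ, u ^ 2 + x ^ 2 + y ^ 2 + v ^ 2 = w ∧ u * x + y * v = a ∧ u * y + x * v = b ∧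
      u * v = h ∧ x * y = m := by
  by_cases hmh : m - h = 0
  · obtain rfl : m = h := sub_eq_zero.1 hmh
    have h0 : a * b - w * m = 0 := by
      have : (a * b - w * m) ^ 2 = 0 := by linear_combination hq
      exact pow_eq_zero_iff (by norm_num) |>.1 this
    -- For m = h the two linear conditions on c and d coincide, since ab = wm. So c and d are taken
    -- as the roots of T² - wT + (a² + b² - 4m²), and r is a square root of its discriminant.
    obtain ⟨r, hr⟩ := IsAlgClosed.exists_pow_nat_eq
      (w ^ 2 - 4 * (a ^ 2 + b ^ 2 - 4 * m * m)) (n := 2) (by norm_num)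
    refine exists_autocov_of_sum_of_mul (c := (w + r) / 2) (d := (w - r) / 2) (by ring) ?_ ?_
    · linear_combination -hr / 4
    · linear_combination -h0
  -- The unique solution of c + d = w, cm + dh = ab; the quartic is the remaining condition on cd.
  · refine exists_autocov_of_sum_of_mul (c := (a * b - w * h) / (m - h))
      (d := (w * m - a * b) / (m - h)) ?_ ?_ ?_
    · field_simp
      ring
    · field_simp
      linear_combination -hq
    · field_simp
      ring

/-- The autocovariances as polynomials in the moving average coefficients. -/
noncomputable def autocovPoly : AutocovIndex q11 → MvPolynomial (CoeffIndex q11) ℂ :=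
  coords (MvPolynomial.X k00 ^ 2 + MvPolynomial.X k10 ^ 2 + MvPolynomial.X k01 ^ 2 +
      MvPolynomial.X k11 ^ 2)
    (MvPolynomial.X k00 * MvPolynomial.X k10 + MvPolynomial.X k01 * MvPolynomial.X k11)
    (MvPolynomial.X k00 * MvPolynomial.X k01 + MvPolynomial.X k10 * MvPolynomial.X k11)
    (MvPolynomial.X k00 * MvPolynomial.X k11) (MvPolynomial.X k10 * MvPolynomial.X k01)

theorem eval_autocovPoly (a : CoeffIndex q11 → ℂ) :
    (fun t => MvPolynomial.eval a (autocovPoly t)) = autocovMap q11 a := by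
  rw [autocovMap_eq, autocovPoly, comp_coords]
  simp

theorem MA_eq_parametrizedSet : MA q11 = parametrizedSet autocovPoly := by
  ext p
  constructor
  · rintro ⟨a, h, rfl⟩
    exact ⟨a, by rwa [eval_autocovPoly], by simp only [eval_autocovPoly]; rfl⟩
  · rintro ⟨a, h, rfl⟩
    exact ⟨a, by rwa [eval_autocovPoly] at h, by simp only [eval_autocovPoly]; rfl⟩

theorem MA_eq_zeroLocus : MA q11 = zeroLocus {quartic} := by
  ext p
  constructor
  · rintro ⟨a, h, rfl⟩
    refine (point_mem_zeroLocus_quartic_iff h).2 ?_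
    rw [eval_quartic, autocovMap_eq]
    simp only [coords_l00, coords_l10, coords_l01, coords_l11, coords_l1m]
    ring
  · obtain ⟨v, hv, rfl⟩ := exists_eq_point p
    intro hp
    rw [point_mem_zeroLocus_quartic_iff, eval_quartic] at hp
    obtain ⟨u, x, y, z, h1, h2, h3, h4, h5⟩ := exists_autocov hp
    obtain ⟨a, rfl, rfl, rfl, rfl⟩ := exists_coeff u x y z
    have e : autocovMap q11 a = v := by
      rw [autocovMap_eq, eq_coords v, h1, h2, h3, h4, h5]
    subst e
    exact ⟨a, hv, rfl⟩

theorem isClosed_MA : IsClosed (MA q11) := by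
  rw [MA_eq_zeroLocus]
  exact isClosed_zeroLocus _

theorem isIrreducible_MA : IsIrreducible (MA q11) := by
  rw [MA_eq_parametrizedSet]
  refine isIrreducible_parametrizedSet fun h => ?_
  have := congrArg (MvPolynomial.eval 1) (congrFun h l11)
  simp [autocovPoly] at this

theorem vanishingIdeal_MA : vanishingIdeal (MA q11) = Ideal.span {quartic} := by
  have hS : ∀ f ∈ ({quartic} : Set CoordRing), ∃ n : ℕ, f.IsHomogeneous n := by
    rintro _ rfl
    exact ⟨4, isHomogeneous_quartic⟩
  have h := isIrreducible_MA.nonempty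
  rw [MA_eq_zeroLocus, ← zeroLocus_span hS] at h ⊢
  exact vanishingIdeal_zeroLocus_span hS isPrime_span_quartic h

/-! ### The three components -/

theorem exists_isHomogeneous_of_mem_P1 :
    ∀ f ∈ ({g10 - g01, g00 - 2 * g11 - 2 * g1m, 4 * g11 * g1m - g01 ^ 2} : Set CoordRing),
      ∃ n : ℕ, f.IsHomogeneous n := by
  have hw := isHomogeneous_g00
  have ha := isHomogeneous_g10
  have hb := isHomogeneous_g01
  have hh := isHomogeneous_g11
  have hm := isHomogeneous_g1m
  rintro f (rfl | rfl | rfl)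
  · exact ⟨1, ha.sub hb⟩
  · exact ⟨1, (hw.sub (isHomogeneous_ofNat_mul hh 2)).sub (isHomogeneous_ofNat_mul hm 2)⟩
  · exact ⟨2, ((isHomogeneous_ofNat_mul hh 4).mul hm).sub (hb.pow 2)⟩

theorem exists_isHomogeneous_of_mem_P2 :
    ∀ f ∈ ({g10 + g01, g00 + 2 * g11 + 2 * g1m, 4 * g11 * g1m - g01 ^ 2} : Set CoordRing),
      ∃ n : ℕ, f.IsHomogeneous n := by
  have hw := isHomogeneous_g00
  have ha := isHomogeneous_g10
  have hb := isHomogeneous_g01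
  have hh := isHomogeneous_g11
  have hm := isHomogeneous_g1m
  rintro f (rfl | rfl | rfl)
  · exact ⟨1, ha.add hb⟩
  · exact ⟨1, (hw.add (isHomogeneous_ofNat_mul hh 2)).add (isHomogeneous_ofNat_mul hm 2)⟩
  · exact ⟨2, ((isHomogeneous_ofNat_mul hh 4).mul hm).sub (hb.pow 2)⟩

theorem exists_isHomogeneous_of_mem_P3 :
    ∀ f ∈ ({g11 - g1m, g00 * g1m - g10 * g01} : Set CoordRing), ∃ n : ℕ, f.IsHomogeneous n := by
  have hw := isHomogeneous_g00
  have ha := isHomogeneous_g10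
  have hb := isHomogeneous_g01
  have hh := isHomogeneous_g11
  have hm := isHomogeneous_g1m
  rintro f (rfl | rfl)
  · exact ⟨1, hh.sub hm⟩
  · exact ⟨2, (hw.mul hm).sub (ha.mul hb)⟩

theorem point_mem_zeroLocus_P1_iff {v : AutocovIndex q11 → ℂ} (h : v ≠ 0) :
    point v h ∈ zeroLocus (P1 : Set CoordRing) ↔
      v l10 - v l01 = 0 ∧ v l00 - 2 * v l11 - 2 * v l1m = 0 ∧
        4 * v l11 * v l1m - v l01 ^ 2 = 0 := by
  rw [P1, point_mem_zeroLocus_span_iff exists_isHomogeneous_of_mem_P1]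
  simp

theorem point_mem_zeroLocus_P2_iff {v : AutocovIndex q11 → ℂ} (h : v ≠ 0) :
    point v h ∈ zeroLocus (P2 : Set CoordRing) ↔
      v l10 + v l01 = 0 ∧ v l00 + 2 * v l11 + 2 * v l1m = 0 ∧
        4 * v l11 * v l1m - v l01 ^ 2 = 0 := by
  rw [P2, point_mem_zeroLocus_span_iff exists_isHomogeneous_of_mem_P2]
  simp

theorem point_mem_zeroLocus_P3_iff {v : AutocovIndex q11 → ℂ} (h : v ≠ 0) :
    point v h ∈ zeroLocus (P3 : Set CoordRing) ↔
      v l11 - v l1m = 0 ∧ v l00 * v l1m - v l10 * v l01 = 0 := by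
  rw [P3, point_mem_zeroLocus_span_iff exists_isHomogeneous_of_mem_P3]
  simp

/-! ### The singular points of the quartic -/

theorem eval_pderiv_quartic (v : AutocovIndex q11 → ℂ) :
    MvPolynomial.eval v (MvPolynomial.pderiv l00 quartic) =
      2 * v l00 * v l11 * v l1m - v l10 * v l01 * (v l11 + v l1m) ∧
    MvPolynomial.eval v (MvPolynomial.pderiv l10 quartic) =
      v l01 * (2 * (v l10 * v l01) - v l00 * (v l11 + v l1m)) +
        2 * v l10 * (v l1m - v l11) ^ 2 ∧
    MvPolynomial.eval v (MvPolynomial.pderiv l01 quartic) =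
      v l10 * (2 * (v l10 * v l01) - v l00 * (v l11 + v l1m)) +
        2 * v l01 * (v l1m - v l11) ^ 2 ∧
    MvPolynomial.eval v (MvPolynomial.pderiv l11 quartic) =
      -v l00 * (v l10 * v l01 - v l00 * v l1m) +
        2 * (v l1m - v l11) * (4 * v l11 * v l1m - v l10 ^ 2 - v l01 ^ 2) -
          4 * v l1m * (v l1m - v l11) ^ 2 ∧
    MvPolynomial.eval v (MvPolynomial.pderiv l1m quartic) =
      -v l00 * (v l10 * v l01 - v l00 * v l11) -
        2 * (v l1m - v l11) * (4 * v l11 * v l1m - v l10 ^ 2 - v l01 ^ 2) -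
          4 * v l11 * (v l1m - v l11) ^ 2 := by
  obtain ⟨h1, h2, h3, h4, h5, h6, h7, h8, h9, h10⟩ := lag_ne
  have hC : ∀ (t : AutocovIndex q11) (k : ℕ) [k.AtLeastTwo],
      MvPolynomial.pderiv t (OfNat.ofNat k : CoordRing) = 0 := fun t k _ =>
    (MvPolynomial.pderiv t).map_natCast k
  refine ⟨?_, ?_, ?_, ?_, ?_⟩ <;>
  · simp [quartic, g00_eq, g10_eq, g01_eq, g11_eq, g1m_eq, MvPolynomial.pderiv_X, hC, h1, h2, h3, h4, h5, h6,
      h7, h8, h9, h10, h1.symm, h2.symm, h3.symm, h4.symm, h5.symm, h6.symm, h7.symm, h8.symm,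
      h9.symm, h10.symm]
    ring

theorem gradient_eq_zero_iff {w a b h m : ℂ} :
    ((a * b - w * h) * (a * b - w * m) - (m - h) ^ 2 * (4 * h * m - a ^ 2 - b ^ 2) = 0 ∧
      2 * w * h * m - a * b * (h + m) = 0 ∧
      b * (2 * (a * b) - w * (h + m)) + 2 * a * (m - h) ^ 2 = 0 ∧
      a * (2 * (a * b) - w * (h + m)) + 2 * b * (m - h) ^ 2 = 0 ∧
      -w * (a * b - w * m) + 2 * (m - h) * (4 * h * m - a ^ 2 - b ^ 2) -
        4 * m * (m - h) ^ 2 = 0 ∧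
      -w * (a * b - w * h) - 2 * (m - h) * (4 * h * m - a ^ 2 - b ^ 2) -
        4 * h * (m - h) ^ 2 = 0) ↔
    ((a - b = 0 ∧ w - 2 * h - 2 * m = 0 ∧ 4 * h * m - b ^ 2 = 0) ∨
      (a + b = 0 ∧ w + 2 * h + 2 * m = 0 ∧ 4 * h * m - b ^ 2 = 0)) ∨
      (h - m = 0 ∧ w * m - a * b = 0) := by
  constructor
  · rintro ⟨hq, hw, ha, hb, hh, hm⟩
    by_cases hmh : h - m = 0
    · obtain rfl : h = m := sub_eq_zero.1 hmh
      have : (w * h - a * b) ^ 2 = 0 := by linear_combination hq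
      exact Or.inr ⟨hmh, pow_eq_zero_iff (by norm_num) |>.1 this⟩
    left
    have key : ∀ w a h m : ℂ, h - m ≠ 0 → (2 * w * h * m - a * a * (h + m) = 0) →
        a * (2 * (a * a) - w * (h + m)) + 2 * a * (m - h) ^ 2 = 0 →
        -w * (a * a - w * m) + 2 * (m - h) * (4 * h * m - a ^ 2 - a ^ 2) -
          4 * m * (m - h) ^ 2 = 0 →
        -w * (a * a - w * h) - 2 * (m - h) * (4 * h * m - a ^ 2 - a ^ 2) -
          4 * h * (m - h) ^ 2 = 0 →
        4 * h * m - a ^ 2 = 0 ∧ (w = 2 * h + 2 * m ∨ a = 0 ∧ w = -(2 * h + 2 * m)) := by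
      intro w a h m hmh hw ha hh hm
      by_cases ha0 : a = 0
      · subst ha0
        by_cases h0 : h = 0
        · subst h0
          have hm0 : m ≠ 0 := fun h => hmh (by rw [h, sub_zero])
          have : (w - 2 * m) * (w + 2 * m) = 0 :=
            mul_left_cancel₀ hm0 (by linear_combination hh)
          refine ⟨by ring, (mul_eq_zero.1 this).imp (fun h => ?_) fun h => ⟨rfl, ?_⟩⟩ <;>
            linear_combination h
        by_cases hm0 : m = 0
        · subst hm0
          have : (w - 2 * h) * (w + 2 * h) = 0 :=
            mul_left_cancel₀ h0 (by linear_combination hm)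
          refine ⟨by ring, (mul_eq_zero.1 this).imp (fun h => ?_) fun h => ⟨rfl, ?_⟩⟩ <;>
            linear_combination h
        -- If a = 0 but hm ≠ 0, then w = 0, and the derivatives in h and m give m = 3h and h = 3m, a
        -- contradiction.
        have hw0 : w = 0 :=
          mul_left_cancel₀ (mul_ne_zero h0 hm0) (by linear_combination hw / 2)
        subst hw0
        have e1 : 3 * h - m = 0 := mul_left_cancel₀ (mul_ne_zero hmh hm0)
          (by linear_combination -hh / 4)
        have e2 : 3 * m - h = 0 := mul_left_cancel₀ (mul_ne_zero hmh h0)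
          (by linear_combination hm / 4)
        exact (h0 (by linear_combination (3 * e1 + e2) / 8)).elim
      · have e : 2 * a ^ 2 - w * (h + m) + 2 * (m - h) ^ 2 = 0 :=
          mul_left_cancel₀ ha0 (by linear_combination ha)
        -- Eliminating w between `e` and `hw` leaves (h - m)²(4hm - a²) = 0.
        have k1 : 4 * h * m - a ^ 2 = 0 := mul_left_cancel₀ (pow_ne_zero 2 hmh)
          (by linear_combination 2 * h * m * e + (h + m) * hw)
        have h0 : h * m ≠ 0 := fun h0 => ha0 (pow_eq_zero_iff (n := 2) (by norm_num) |>.1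
          (by linear_combination 4 * h0 - k1))
        exact ⟨k1, Or.inl (mul_left_cancel₀ h0 (by linear_combination (hw - (h + m) * k1) / 2))⟩
    have hab : (a - b) * (a + b) = 0 := by
      -- Combining a times the derivative in a with b times the derivative in b cancels the mixed
      -- terms.
      have : (a - b) * (a + b) * (h - m) ^ 2 = 0 := by linear_combination (a * ha - b * hb) / 2
      exact (mul_eq_zero.1 this).resolve_right (pow_ne_zero 2 hmh)
    rcases mul_eq_zero.1 hab with h0 | h0
    · obtain rfl : a = b := sub_eq_zero.1 h0
      obtain ⟨k1, k2 | ⟨rfl, k2⟩⟩ := key w a h m hmh hw ha hh hm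
      · exact Or.inl ⟨h0, by linear_combination k2, k1⟩
      · exact Or.inr ⟨by simp, by linear_combination k2, k1⟩
    · obtain rfl : b = -a := by linear_combination h0
      -- The symmetry (w, b) ↦ (-w, -b) of the quartic exchanges the two conics and reduces b = -a
      -- to the case b = a.
      obtain ⟨k1, k2 | ⟨rfl, k2⟩⟩ := key (-w) a h m hmh (by linear_combination -hw)
        (by linear_combination ha) (by linear_combination hh)
        (by linear_combination hm)
      · exact Or.inr ⟨h0, by linear_combination -k2, by linear_combination k1⟩
      · exact Or.inl ⟨by simp, by linear_combination -k2, by linear_combination k1⟩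
  · rintro ((⟨h1, h2, h3⟩ | ⟨h1, h2, h3⟩) | ⟨h1, h2⟩)
    · obtain rfl : a = b := by linear_combination h1
      obtain rfl : w = 2 * h + 2 * m := by linear_combination h2
      refine ⟨?_, ?_, ?_, ?_, ?_, ?_⟩
      · linear_combination (4 * h * m - a ^ 2) * h3
      · linear_combination (h + m) * h3
      · linear_combination -2 * a * h3
      · linear_combination -2 * a * h3
      · linear_combination (6 * m - 2 * h) * h3
      · linear_combination (6 * h - 2 * m) * h3
    · obtain rfl : a = -b := by linear_combination h1
      obtain rfl : w = -(2 * h + 2 * m) := by linear_combination h2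
      refine ⟨?_, ?_, ?_, ?_, ?_, ?_⟩
      · linear_combination (4 * h * m - b ^ 2) * h3
      · linear_combination -(h + m) * h3
      · linear_combination 2 * b * h3
      · linear_combination -2 * b * h3
      · linear_combination (6 * m - 2 * h) * h3
      · linear_combination (6 * h - 2 * m) * h3
    · obtain rfl : h = m := sub_eq_zero.1 h1
      refine ⟨?_, ?_, ?_, ?_, ?_, ?_⟩
      · linear_combination (w * h - a * b) * h2
      · linear_combination 2 * h * h2
      · linear_combination -2 * b * h2
      · linear_combination -2 * a * h2
      · linear_combination w * h2
      · linear_combination w * h2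

/-! ### Parametrizations of the components -/

/-- The parametrization of the conic defined by `P1`. -/
noncomputable def conicPoly₁ : AutocovIndex q11 → MvPolynomial (Fin 2) ℂ :=
  coords (2 * MvPolynomial.X 0 ^ 2 + 2 * MvPolynomial.X 1 ^ 2)
    (2 * (MvPolynomial.X 0 * MvPolynomial.X 1)) (2 * (MvPolynomial.X 0 * MvPolynomial.X 1))
    (MvPolynomial.X 0 ^ 2) (MvPolynomial.X 1 ^ 2)

/-- The parametrization of the conic defined by `P2`. -/
noncomputable def conicPoly₂ : AutocovIndex q11 → MvPolynomial (Fin 2) ℂ :=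
  coords (-(2 * MvPolynomial.X 0 ^ 2 + 2 * MvPolynomial.X 1 ^ 2))
    (-(2 * (MvPolynomial.X 0 * MvPolynomial.X 1))) (2 * (MvPolynomial.X 0 * MvPolynomial.X 1))
    (MvPolynomial.X 0 ^ 2) (MvPolynomial.X 1 ^ 2)

/-- The Segre parametrization of the quadric surface defined by `P3`. -/
noncomputable def segrePoly : AutocovIndex q11 → MvPolynomial (Fin 4) ℂ :=
  coords (MvPolynomial.X 0 * MvPolynomial.X 2) (MvPolynomial.X 0 * MvPolynomial.X 3)
    (MvPolynomial.X 1 * MvPolynomial.X 2) (MvPolynomial.X 1 * MvPolynomial.X 3)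
    (MvPolynomial.X 1 * MvPolynomial.X 3)

theorem eq_parametrizedSet {ι : Type} {Z : Set (ProjSpace (AutocovIndex q11))}
    {φ : AutocovIndex q11 → MvPolynomial ι ℂ}
    (h : ∀ (v : AutocovIndex q11 → ℂ) (hv : v ≠ 0), point v hv ∈ Z ↔
      ∃ x : ι → ℂ, (fun t => MvPolynomial.eval x (φ t)) = v) :
    Z = parametrizedSet φ := by
  ext p
  obtain ⟨v, hv, rfl⟩ := exists_eq_point p
  constructor
  · intro hp
    obtain ⟨x, rfl⟩ := (h v hv).1 hp
    exact ⟨x, hv, rfl⟩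
  · rintro ⟨x, hx, he⟩
    rw [he]
    exact (h _ hx).2 ⟨x, rfl⟩

theorem coords_eq_iff {A : Type*} {w a b h m : A} {v : AutocovIndex q11 → A} :
    coords w a b h m = v ↔ w = v l00 ∧ a = v l10 ∧ b = v l01 ∧ h = v l11 ∧ m = v l1m := by
  rw [funext_iff, forall_autocovIndex]
  simp

theorem zeroLocus_P1_eq : zeroLocus (P1 : Set CoordRing) = parametrizedSet conicPoly₁ := by
  refine eq_parametrizedSet fun v hv => ?_
  rw [point_mem_zeroLocus_P1_iff]
  simp only [conicPoly₁, comp_coords, coords_eq_iff]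
  simp
  constructor
  · rintro ⟨h1, h2, h3⟩
    -- The parameters are square roots of g11 and g1m with signs chosen so that st = g01 / 2.
    obtain ⟨s, t, hs, ht, hst⟩ := exists_sq_mul_eq (A := v l11) (B := v l1m) (s := v l01 / 2)
      (by linear_combination h3 / 4)
    refine ⟨![s, t], ?_, ?_, ?_, hs, ht⟩ <;> simp
    · linear_combination 2 * hs + 2 * ht - h2
    · linear_combination 2 * hst - h1
    · linear_combination 2 * hst
  · rintro ⟨x, h1, h2, h3, h4, h5⟩
    rw [← h1, ← h2, ← h3, ← h4, ← h5]
    refine ⟨?_, ?_, ?_⟩ <;> ring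

theorem zeroLocus_P2_eq : zeroLocus (P2 : Set CoordRing) = parametrizedSet conicPoly₂ := by
  refine eq_parametrizedSet fun v hv => ?_
  rw [point_mem_zeroLocus_P2_iff]
  simp only [conicPoly₂, comp_coords, coords_eq_iff]
  simp
  constructor
  · rintro ⟨h1, h2, h3⟩
    obtain ⟨s, t, hs, ht, hst⟩ := exists_sq_mul_eq (A := v l11) (B := v l1m) (s := v l01 / 2)
      (by linear_combination h3 / 4)
    refine ⟨![s, t], ?_, ?_, ?_, hs, ht⟩ <;> simp
    · linear_combination -2 * hs - 2 * ht - h2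
    · linear_combination -2 * hst - h1
    · linear_combination 2 * hst
  · rintro ⟨x, h1, h2, h3, h4, h5⟩
    rw [← h1, ← h2, ← h3, ← h4, ← h5]
    refine ⟨?_, ?_, ?_⟩ <;> ring

/-- With rows (w, a) and (b, m), the quadric is the vanishing of a 2 × 2 determinant, and such a
matrix is the product of a column and a row. -/
theorem zeroLocus_P3_eq : zeroLocus (P3 : Set CoordRing) = parametrizedSet segrePoly := by
  refine eq_parametrizedSet fun v hv => ?_
  rw [point_mem_zeroLocus_P3_iff]
  simp only [segrePoly, comp_coords, coords_eq_iff]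
  simp
  constructor
  · rintro ⟨h1, h2⟩
    have h1' : v l11 = v l1m := sub_eq_zero.1 h1
    by_cases hw : v l00 = 0
    · have : v l10 * v l01 = 0 := by linear_combination -h2 + v l1m * hw
      rcases mul_eq_zero.1 this with h | h
      · exact ⟨![0, 1, v l01, v l1m], by simp [hw, h, h1']⟩
      · exact ⟨![v l10, v l1m, 0, 1], by simp [hw, h, h1']⟩
    · refine ⟨![1, v l01 / v l00, v l00, v l10], ?_, ?_, ?_, ?_, ?_⟩ <;> simp
      · field_simp
      · rw [h1']
        field_simp
        linear_combination -h2
      · field_simp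
        linear_combination -h2
  · rintro ⟨x, h1, h2, h3, h4, h5⟩
    rw [← h1, ← h2, ← h3, ← h4, ← h5]
    refine ⟨?_, ?_⟩ <;> ring

theorem conicPoly₁_ne_zero : conicPoly₁ ≠ 0 := by
  intro h
  have := congrArg (MvPolynomial.eval 1) (congrFun h l11)
  simp [conicPoly₁] at this

theorem conicPoly₂_ne_zero : conicPoly₂ ≠ 0 := by
  intro h
  have := congrArg (MvPolynomial.eval 1) (congrFun h l11)
  simp [conicPoly₂] at this

theorem segrePoly_ne_zero : segrePoly ≠ 0 := by
  intro h
  have := congrArg (MvPolynomial.eval 1) (congrFun h l11)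
  simp [segrePoly] at this

theorem isIrreducible_zeroLocus_P1 : IsIrreducible (zeroLocus (P1 : Set CoordRing)) := by
  rw [zeroLocus_P1_eq]
  exact isIrreducible_parametrizedSet conicPoly₁_ne_zero

theorem isIrreducible_zeroLocus_P2 : IsIrreducible (zeroLocus (P2 : Set CoordRing)) := by
  rw [zeroLocus_P2_eq]
  exact isIrreducible_parametrizedSet conicPoly₂_ne_zero

theorem isIrreducible_zeroLocus_P3 : IsIrreducible (zeroLocus (P3 : Set CoordRing)) := by
  rw [zeroLocus_P3_eq]
  exact isIrreducible_parametrizedSet segrePoly_ne_zero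

theorem vanishingIdeal_zeroLocus_P1 : vanishingIdeal (zeroLocus (P1 : Set CoordRing)) = P1 :=
  vanishingIdeal_zeroLocus_span exists_isHomogeneous_of_mem_P1 isPrime_P1
    isIrreducible_zeroLocus_P1.nonempty

theorem vanishingIdeal_zeroLocus_P2 : vanishingIdeal (zeroLocus (P2 : Set CoordRing)) = P2 :=
  vanishingIdeal_zeroLocus_span exists_isHomogeneous_of_mem_P2 isPrime_P2
    isIrreducible_zeroLocus_P2.nonempty

theorem vanishingIdeal_zeroLocus_P3 : vanishingIdeal (zeroLocus (P3 : Set CoordRing)) = P3 :=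
  vanishingIdeal_zeroLocus_span exists_isHomogeneous_of_mem_P3 isPrime_P3
    isIrreducible_zeroLocus_P3.nonempty

/-! ### Dimensions -/

theorem zeroLocus_P3_subset_MA : zeroLocus (P3 : Set CoordRing) ⊆ MA q11 := by
  rw [MA_eq_zeroLocus]
  intro p
  obtain ⟨v, hv, rfl⟩ := exists_eq_point p
  rw [point_mem_zeroLocus_P3_iff, point_mem_zeroLocus_quartic_iff, eval_quartic]
  rintro ⟨h1, h2⟩
  obtain h1' : v l11 = v l1m := sub_eq_zero.1 h1
  rw [h1']
  linear_combination (v l00 * v l1m - v l10 * v l01) * h2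

/-- The coordinate point of g00 and the line g10 = g11 = g1m = 0 inside the quadric surface; they
start the chains for both lower bounds on dimension. -/
theorem exists_chain : ∃ A₀ A₁ : Set (ProjSpace (AutocovIndex q11)),
    (IsClosed A₀ ∧ IsIrreducible A₀) ∧ (IsClosed A₁ ∧ IsIrreducible A₁) ∧ A₀ ⊂ A₁ ∧
      A₁ ⊂ zeroLocus (P3 : Set CoordRing) := by
  have mem : ∀ (S : Set CoordRing), (∀ f ∈ S, ∃ t, f = MvPolynomial.X t) →
      ∀ (v : AutocovIndex q11 → ℂ) (hv : v ≠ 0),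
      point v hv ∈ zeroLocus (Ideal.span S : Set CoordRing) ↔
        ∀ f ∈ S, MvPolynomial.eval v f = 0 := by
    intro S hS v hv
    refine point_mem_zeroLocus_span_iff (fun f hf => ?_) hv
    obtain ⟨t, rfl⟩ := hS f hf
    exact ⟨1, MvPolynomial.isHomogeneous_X _ _⟩
  have mem₀ := mem {g10, g01, g11, g1m} (by
    rintro f (rfl | rfl | rfl | rfl) <;> exact ⟨_, rfl⟩)
  have mem₁ := mem {g10, g11, g1m} (by rintro f (rfl | rfl | rfl) <;> exact ⟨_, rfl⟩)
  simp only [Set.mem_insert_iff, Set.mem_singleton_iff, forall_eq_or_imp, forall_eq, eval_g10,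
    eval_g01, eval_g11, eval_g1m] at mem₀ mem₁
  refine ⟨zeroLocus (Ideal.span {g10, g01, g11, g1m} : Ideal CoordRing),
    zeroLocus (Ideal.span {g10, g11, g1m} : Ideal CoordRing), ⟨isClosed_zeroLocus _, ?_⟩,
    ⟨isClosed_zeroLocus _, ?_⟩, ⟨?_, ?_⟩, ?_, ?_⟩
  · rw [eq_parametrizedSet (Z := zeroLocus (Ideal.span {g10, g01, g11, g1m} : Ideal CoordRing))
      (φ := coords (MvPolynomial.X () : MvPolynomial Unit ℂ) 0 0 0 0)]
    · refine isIrreducible_parametrizedSet fun h => ?_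
      have := congrArg (MvPolynomial.eval 1) (congrFun h l00)
      simp at this
    · intro v hv
      rw [mem₀]
      simp only [comp_coords, coords_eq_iff, MvPolynomial.eval_X, map_zero]
      constructor
      · rintro ⟨h1, h2, h3, h4⟩
        exact ⟨fun _ => v l00, rfl, h1.symm, h2.symm, h3.symm, h4.symm⟩
      · rintro ⟨x, -, h1, h2, h3, h4⟩
        exact ⟨h1.symm, h2.symm, h3.symm, h4.symm⟩
  · rw [eq_parametrizedSet (Z := zeroLocus (Ideal.span {g10, g11, g1m} : Ideal CoordRing))
      (φ := coords (MvPolynomial.X 0 : MvPolynomial (Fin 2) ℂ) 0 (MvPolynomial.X 1) 0 0)]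
    · refine isIrreducible_parametrizedSet fun h => ?_
      have := congrArg (MvPolynomial.eval 1) (congrFun h l00)
      simp at this
    · intro v hv
      rw [mem₁]
      simp only [comp_coords, coords_eq_iff, MvPolynomial.eval_X, map_zero]
      constructor
      · rintro ⟨h1, h2, h3⟩
        exact ⟨![v l00, v l01], rfl, h1.symm, rfl, h2.symm, h3.symm⟩
      · rintro ⟨x, -, h1, -, h2, h3⟩
        exact ⟨h1.symm, h2.symm, h3.symm⟩
  · intro p
    obtain ⟨v, hv, rfl⟩ := exists_eq_point p
    intro hp
    obtain ⟨h1, h2, h3, h4⟩ := (mem₀ v hv).1 hp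
    exact (mem₁ v hv).2 ⟨h1, h3, h4⟩
  · intro h
    have hv : coords (0 : ℂ) 0 1 0 0 ≠ 0 := by simp [coords_ne_zero_iff]
    have := (mem₀ _ hv).1 (h ((mem₁ _ hv).2 (by simp)))
    simp at this
  · intro p
    obtain ⟨v, hv, rfl⟩ := exists_eq_point p
    intro hp
    obtain ⟨h1, h2, h3⟩ := (mem₁ v hv).1 hp
    rw [point_mem_zeroLocus_P3_iff]
    simp [h1, h2, h3]
  · intro h
    have hv : coords (0 : ℂ) 1 0 0 0 ≠ 0 := by simp [coords_ne_zero_iff]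
    have := (mem₁ _ hv).1 (h ((point_mem_zeroLocus_P3_iff hv).2 (by simp)))
    simp at this

theorem bot_lt_vanishingIdeal {Z : Set (ProjSpace (AutocovIndex q11))} (hZ : Z ⊆ MA q11) :
    ⊥ < vanishingIdeal Z := by
  refine bot_lt_iff_ne_bot.2 fun h => quartic_ne_zero ?_
  have := vanishingIdeal_anti hZ (vanishingIdeal_MA ▸ Ideal.mem_span_singleton_self quartic)
  rwa [h] at this

theorem card_autocovIndex' : Nat.card (AutocovIndex q11) = 5 := by
  rw [Nat.card_eq_fintype_card, card_autocovIndex]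

theorem one_le_height_vanishingIdeal {Z : Set (ProjSpace (AutocovIndex q11))} (hZ : Z ⊆ MA q11)
    (hirr : IsIrreducible Z) :
    ((1 : ℕ) : ℕ∞) ≤ Order.height (⟨vanishingIdeal Z, isPrime_vanishingIdeal hirr⟩ :
      PrimeSpectrum CoordRing) := by
  have h : (⊥ : PrimeSpectrum CoordRing) <
      ⟨vanishingIdeal Z, isPrime_vanishingIdeal hirr⟩ := bot_lt_vanishingIdeal hZ
  refine le_trans ?_ (Order.height_add_one_le h)
  simp

theorem exists_mem_MA_not_mem_zeroLocus_P3 :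
    ∃ p ∈ MA q11, p ∉ zeroLocus (P3 : Set CoordRing) := by
  have hv : coords (0 : ℂ) 0 0 1 0 ≠ 0 := by simp [coords_ne_zero_iff]
  refine ⟨point _ hv, ?_, ?_⟩
  · rw [MA_eq_zeroLocus, point_mem_zeroLocus_quartic_iff, eval_quartic]
    simp
  · rw [point_mem_zeroLocus_P3_iff]
    simp

theorem topologicalKrullDim_MA : topologicalKrullDim (MA q11) = 3 := by
  apply le_antisymm
  · exact topologicalKrullDim_le (k := 1) (d := 3) isClosed_MA
      (fun Z hZ _ hirr => one_le_height_vanishingIdeal hZ hirr) (by rw [card_autocovIndex'])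
  · obtain ⟨A₀, A₁, ⟨c₀, i₀⟩, ⟨c₁, i₁⟩, h₀, h₁⟩ := exists_chain
    have h₂ : zeroLocus (P3 : Set CoordRing) ⊂ MA q11 := by
      obtain ⟨p, hp, hp'⟩ := exists_mem_MA_not_mem_zeroLocus_P3
      exact ⟨zeroLocus_P3_subset_MA, fun h => hp' (h hp)⟩
    refine le_topologicalKrullDim (n := 3) ![A₀, A₁, zeroLocus (P3 : Set CoordRing), MA q11]
      ?_ ?_ ?_ ?_
    · rw [Fin.strictMono_iff_lt_succ]
      intro i
      fin_cases i
      exacts [h₀, h₁, h₂]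
    · intro i
      fin_cases i
      exacts [c₀, c₁, isClosed_zeroLocus _, isClosed_MA]
    · intro i
      fin_cases i
      exacts [i₀, i₁, isIrreducible_zeroLocus_P3, isIrreducible_MA]
    · intro i
      fin_cases i
      exacts [h₀.subset.trans (h₁.subset.trans h₂.subset), h₁.subset.trans h₂.subset, h₂.subset,
        subset_rfl]

theorem singularLocus_MA : singularLocus (MA q11) =
    zeroLocus (P1 : Set CoordRing) ∪ zeroLocus (P2 : Set CoordRing) ∪
      zeroLocus (P3 : Set CoordRing) := by
  rw [singularLocus_eq vanishingIdeal_MA (d := 3) topologicalKrullDim_MA card_autocovIndex,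
    MA_eq_zeroLocus]
  ext p
  obtain ⟨v, hv, rfl⟩ := exists_eq_point p
  have hd : ∀ t, (MvPolynomial.pderiv t quartic).IsHomogeneous 3 := fun t =>
    isHomogeneous_quartic.pderiv
  simp only [Set.mem_ofPred_eq, Set.mem_union, point_mem_zeroLocus_P1_iff,
    point_mem_zeroLocus_P2_iff, point_mem_zeroLocus_P3_iff, point_mem_zeroLocus_quartic_iff,
    eval_rep_point_eq_zero_iff (hd _)]
  obtain ⟨e1, e2, e3, e4, e5⟩ := eval_pderiv_quartic v
  rw [forall_autocovIndex, e1, e2, e3, e4, e5, eval_quartic]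
  exact gradient_eq_zero_iff

theorem isClosed_singularLocus_MA : IsClosed (singularLocus (MA q11)) := by
  rw [singularLocus_MA]
  exact ((isClosed_zeroLocus _).union (isClosed_zeroLocus _)).union (isClosed_zeroLocus _)

/-- The point whose only nonzero coordinate is g11 is a smooth point of the variety. So the prime of
an irreducible closed singular set lies strictly above that of the variety, and its height is at
least 2; the quadric surface attains the bound. -/
theorem topologicalKrullDim_singularLocus_MA :
    topologicalKrullDim (singularLocus (MA q11)) = 2 := by
  have hP3 : zeroLocus (P3 : Set CoordRing) ⊆ singularLocus (MA q11) := by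
    rw [singularLocus_MA]
    exact Set.subset_union_right
  apply le_antisymm
  · refine topologicalKrullDim_le (k := 2) (d := 2) isClosed_singularLocus_MA
      (fun Z hZ hcl hirr => ?_) (by rw [card_autocovIndex'])
    have hZ' : Z ⊆ MA q11 := hZ.trans fun p hp => hp.1
    have hlt : (⟨vanishingIdeal (MA q11), isPrime_vanishingIdeal isIrreducible_MA⟩ :
        PrimeSpectrum CoordRing) < ⟨vanishingIdeal Z, isPrime_vanishingIdeal hirr⟩ := by
      refine lt_of_le_not_ge (vanishingIdeal_anti hZ') fun h => ?_
      have h' : MA q11 ⊆ singularLocus (MA q11) := by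
        refine Set.Subset.trans ?_ hZ
        rw [← zeroLocus_vanishingIdeal hcl]
        rw [← zeroLocus_vanishingIdeal isClosed_MA]
        exact fun p hp f hf => hp f (h hf)
      have hv : coords (0 : ℂ) 0 0 1 0 ≠ 0 := by simp [coords_ne_zero_iff]
      have h1 : point _ hv ∈ MA q11 := by
        rw [MA_eq_zeroLocus, point_mem_zeroLocus_quartic_iff, eval_quartic]
        simp
      have h2 := h' h1
      rw [singularLocus_MA] at h2
      simp [point_mem_zeroLocus_P1_iff, point_mem_zeroLocus_P2_iff,
        point_mem_zeroLocus_P3_iff] at h2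
    calc ((2 : ℕ) : ℕ∞) = ((1 : ℕ) : ℕ∞) + 1 := by norm_num
      _ ≤ _ := by
        gcongr
        exact one_le_height_vanishingIdeal subset_rfl isIrreducible_MA
      _ ≤ _ := Order.height_add_one_le hlt
  · obtain ⟨A₀, A₁, ⟨c₀, i₀⟩, ⟨c₁, i₁⟩, h₀, h₁⟩ := exists_chain
    refine le_topologicalKrullDim (n := 2) ![A₀, A₁, zeroLocus (P3 : Set CoordRing)] ?_ ?_ ?_ ?_
    · rw [Fin.strictMono_iff_lt_succ]
      intro i
      fin_cases i
      exacts [h₀, h₁]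
    · intro i
      fin_cases i
      exacts [c₀, c₁, isClosed_zeroLocus _]
    · intro i
      fin_cases i
      exacts [i₀, i₁, isIrreducible_zeroLocus_P3]
    · intro i
      fin_cases i
      exacts [h₀.subset.trans (h₁.subset.trans hP3), h₁.subset.trans hP3, hP3]

/-! ### The degree of the variety -/

theorem hasDegree_MA : HasDegree (MA q11) 4 := by
  -- This cubic is the difference of the binomial coefficients of n + 4 and n over 4; its leading
  -- coefficient times 3! is 4.
  refine ⟨Polynomial.C (2 / 3) * Polynomial.X ^ 3 + Polynomial.C 1 * Polynomial.X ^ 2 +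
    Polynomial.C (7 / 3) * Polynomial.X + Polynomial.C 1, ?_, ?_⟩
  · filter_upwards [Filter.eventually_ge_atTop 4] with n hn
    obtain ⟨m, rfl⟩ := Nat.exists_eq_add_of_le' hn
    have h := hilbertFunction_add_of_vanishingIdeal_eq_span_singleton isHomogeneous_quartic
      quartic_ne_zero vanishingIdeal_MA m
    rw [card_autocovIndex, show 5 + m - 1 = m + 4 by omega,
      show 5 + (m + 4) - 1 = m + 4 + 4 by omega, Nat.choose_symm_add, Nat.choose_symm_add] at h
    have hc : ∀ n : ℕ, ((n + 4).choose 4 : ℚ) = (n + 4) * (n + 3) * (n + 2) * (n + 1) / 24 := by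
      intro n
      have := Nat.descFactorial_eq_factorial_mul_choose (n + 4) 4
      simp [Nat.descFactorial, Nat.factorial] at this
      have h2 : ((n + 1) * ((n + 2) * ((n + 3) * (n + 4))) : ℚ) = 24 * ((n + 4).choose 4 : ℚ) := by
        exact_mod_cast this
      linarith
    have h' : (hilbertFunction (MA q11) (m + 4) : ℚ) + ((m + 4).choose 4 : ℕ) =
        ((m + 4 + 4).choose 4 : ℕ) := by exact_mod_cast h
    rw [hc, hc] at h'
    rw [← sub_eq_iff_eq_add.2 h'.symm]
    simp
    ring
  · rw [Polynomial.leadingCoeff_cubic (by norm_num), Polynomial.natDegree_cubic (by norm_num)]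
    norm_num [Nat.factorial]

/-! ### Spanning sets of monomials -/

theorem prod_autocovIndex {M : Type*} [CommMonoid M] (f : AutocovIndex q11 → M) :
    ∏ t, f t = f l00 * (f l10 * (f l01 * (f l11 * f l1m))) := by
  obtain ⟨h1, h2, h3, h4, h5, h6, h7, h8, h9, h10⟩ := lag_ne
  rw [univ_autocovIndex, Finset.prod_insert, Finset.prod_insert, Finset.prod_insert,
    Finset.prod_insert, Finset.prod_singleton] <;> simp [*]

theorem homogeneousSubmodule_eq_span (σ : Type) (n : ℕ) :
    MvPolynomial.homogeneousSubmodule σ ℂ n =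
      Submodule.span ℂ ((fun d => MvPolynomial.monomial d 1) '' {d : σ →₀ ℕ | d.degree = n}) := by
  rw [MvPolynomial.homogeneousSubmodule_eq_finsupp_supported,
    AddMonoidAlgebra.supported_eq_span_single]
  rfl

theorem monomial_fin_two (d : Fin 2 →₀ ℕ) :
    (MvPolynomial.monomial d 1 : MvPolynomial (Fin 2) ℂ) =
      MvPolynomial.X 0 ^ d 0 * MvPolynomial.X 1 ^ d 1 := by
  rw [MvPolynomial.monomial_eq, Finsupp.prod_fintype _ _ (by simp), Fin.prod_univ_two]
  simp

theorem monomial_fin_four (d : Fin 4 →₀ ℕ) :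
    (MvPolynomial.monomial d 1 : MvPolynomial (Fin 4) ℂ) =
      MvPolynomial.X 0 ^ d 0 * MvPolynomial.X 1 ^ d 1 * MvPolynomial.X 2 ^ d 2 *
        MvPolynomial.X 3 ^ d 3 := by
  rw [MvPolynomial.monomial_eq, Finsupp.prod_fintype _ _ (by simp), Fin.prod_univ_four]
  simp

/-! ### The quadric surface -/

/-- The exponents of the monomials of bidegree `(m, m)` with exponents `i` and `j` of the first
variables of both pairs. -/
noncomputable def segreExponent (m : ℕ) (p : Fin (m + 1) × Fin (m + 1)) : Fin 4 →₀ ℕ :=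
  Finsupp.equivFunOnFinite.symm ![(p.1 : ℕ), m - p.1, p.2, m - p.2]

theorem segreExponent_injective (m : ℕ) : Function.Injective (segreExponent m) := by
  intro p q h
  have h0 := DFunLike.congr_fun h 0
  have h2 := DFunLike.congr_fun h 2
  simp [segreExponent] at h0 h2
  exact Prod.ext (Fin.ext h0) (Fin.ext h2)

/-- The degree m forms on the Segre quadric are the bihomogeneous forms of bidegree (m, m); their
monomials give the count (m + 1)². -/
theorem map_segrePoly (m : ℕ) :
    (MvPolynomial.homogeneousSubmodule (AutocovIndex q11) ℂ m).map
      (MvPolynomial.aeval segrePoly : CoordRing →ₐ[ℂ] MvPolynomial (Fin 4) ℂ).toLinearMap =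
    Submodule.span ℂ (Set.range fun p => MvPolynomial.monomial (segreExponent m p) (1 : ℂ)) := by
  apply le_antisymm
  · rw [homogeneousSubmodule_eq_span, Submodule.map_span, Submodule.span_le]
    rintro _ ⟨_, ⟨d, hd, rfl⟩, rfl⟩
    have hd' : d l00 + (d l10 + (d l01 + (d l11 + d l1m))) = m := by
      rw [← sum_autocovIndex, ← Finsupp.degree_eq_sum]
      exact hd
    refine Submodule.subset_span ⟨(⟨d l00 + d l10, by omega⟩, ⟨d l00 + d l01, by omega⟩), ?_⟩
    have e1 : m - (d l00 + d l10) = d l01 + d l11 + d l1m := by omega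
    have e2 : m - (d l00 + d l01) = d l10 + d l11 + d l1m := by omega
    simp only [AlgHom.toLinearMap_apply, MvPolynomial.aeval_monomial, map_one, one_mul]
    rw [Finsupp.prod_fintype _ _ (by simp), prod_autocovIndex, monomial_fin_four]
    simp [segreExponent, segrePoly, e1, e2]
    ring
  · rw [Submodule.span_le]
    rintro _ ⟨⟨i, j⟩, rfl⟩
    -- The exponent of g00 is the minimum of i and j; at least one of g10 and g01 then has exponent
    -- zero.
    obtain ⟨w, a, b, h, hi, hj, hm⟩ : ∃ w a b h : ℕ, (i : ℕ) = w + a ∧ (j : ℕ) = w + b ∧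
        m = w + a + b + h := by
      have := i.2
      have := j.2
      rcases le_total (i : ℕ) j with hij | hij
      · exact ⟨i, 0, j - i, m - j, by omega, by omega, by omega⟩
      · exact ⟨j, i - j, 0, m - i, by omega, by omega, by omega⟩
    refine ⟨g00 ^ w * g10 ^ a * g01 ^ b * g11 ^ h, ?_, ?_⟩
    · have := (((isHomogeneous_g00.pow w).mul (isHomogeneous_g10.pow a)).mul
        (isHomogeneous_g01.pow b)).mul (isHomogeneous_g11.pow h)
      rw [one_mul, one_mul, one_mul, one_mul, ← hm] at this
      exact this
    · have e1 : m - (w + a) = b + h := by omega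
      have e2 : m - (w + b) = a + h := by omega
      simp only [monomial_fin_four, AlgHom.toLinearMap_apply, map_mul, map_pow, aeval_g00,
        aeval_g10, aeval_g01, aeval_g11]
      simp [segreExponent, segrePoly, hi, hj, e1, e2]
      ring

theorem finrank_map_segrePoly (m : ℕ) :
    Module.finrank ℂ ((MvPolynomial.homogeneousSubmodule (AutocovIndex q11) ℂ m).map
      (MvPolynomial.aeval segrePoly : CoordRing →ₐ[ℂ] MvPolynomial (Fin 4) ℂ).toLinearMap) =
    (m + 1) ^ 2 := by
  have hli : LinearIndependent ℂ
      (fun p => MvPolynomial.monomial (segreExponent m p) (1 : ℂ)) := by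
    have := (MvPolynomial.basisMonomials (Fin 4) ℂ).linearIndependent.comp _
      (segreExponent_injective m)
    simpa [Function.comp_def] using this
  rw [map_segrePoly, finrank_span_eq_card hli]
  simp [sq]

/-! ### The two conics -/

/-- The pair of parametrizations of the two conics. -/
noncomputable def conicPair :
    CoordRing →ₐ[ℂ] MvPolynomial (Fin 2) ℂ × MvPolynomial (Fin 2) ℂ :=
  (MvPolynomial.aeval conicPoly₁).prod (MvPolynomial.aeval conicPoly₂)

theorem isHomogeneous_aeval_of_isHomogeneous {σ τ : Type} {φ : σ → MvPolynomial τ ℂ} {e m : ℕ}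
    (hφ : ∀ t, (φ t).IsHomogeneous e) {f : MvPolynomial σ ℂ} (hf : f.IsHomogeneous m) :
    (MvPolynomial.aeval φ f).IsHomogeneous (e * m) := by
  exact hf.aeval φ hφ

theorem isHomogeneous_conicPoly₁ (t : AutocovIndex q11) : (conicPoly₁ t).IsHomogeneous 2 := by
  have h0 := MvPolynomial.isHomogeneous_X ℂ (0 : Fin 2)
  have h1 := MvPolynomial.isHomogeneous_X ℂ (1 : Fin 2)
  revert t
  rw [forall_autocovIndex]
  simp only [conicPoly₁, coords_l00, coords_l10, coords_l01, coords_l11, coords_l1m]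
  exact ⟨(isHomogeneous_ofNat_mul (h0.pow 2) 2).add (isHomogeneous_ofNat_mul (h1.pow 2) 2),
    isHomogeneous_ofNat_mul (h0.mul h1) 2, isHomogeneous_ofNat_mul (h0.mul h1) 2, h0.pow 2,
    h1.pow 2⟩

theorem isHomogeneous_conicPoly₂ (t : AutocovIndex q11) : (conicPoly₂ t).IsHomogeneous 2 := by
  have h0 := MvPolynomial.isHomogeneous_X ℂ (0 : Fin 2)
  have h1 := MvPolynomial.isHomogeneous_X ℂ (1 : Fin 2)
  revert t
  rw [forall_autocovIndex]
  simp only [conicPoly₂, coords_l00, coords_l10, coords_l01, coords_l11, coords_l1m]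
  exact ⟨((isHomogeneous_ofNat_mul (h0.pow 2) 2).add (isHomogeneous_ofNat_mul (h1.pow 2) 2)).neg,
    (isHomogeneous_ofNat_mul (h0.mul h1) 2).neg, isHomogeneous_ofNat_mul (h0.mul h1) 2, h0.pow 2,
    h1.pow 2⟩

theorem conicPair_apply (f : CoordRing) : conicPair f =
    (MvPolynomial.aeval conicPoly₁ f, MvPolynomial.aeval conicPoly₂ f) := rfl

theorem conicPair_g11 : conicPair g11 = (MvPolynomial.X 0 ^ 2, MvPolynomial.X 0 ^ 2) := by
  simp only [conicPair_apply, aeval_g11, conicPoly₁, conicPoly₂, coords_l11]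

theorem conicPair_g1m : conicPair g1m = (MvPolynomial.X 1 ^ 2, MvPolynomial.X 1 ^ 2) := by
  simp only [conicPair_apply, aeval_g1m, conicPoly₁, conicPoly₂, coords_l1m]

theorem conicPair_g01 : conicPair g01 =
    (2 * (MvPolynomial.X 0 * MvPolynomial.X 1), 2 * (MvPolynomial.X 0 * MvPolynomial.X 1)) := by
  simp only [conicPair_apply, aeval_g01, conicPoly₁, conicPoly₂, coords_l01]

/-- If linear forms restricting to `st` and `s ^ 2 + t ^ 2` on one of the two conics vanish on the
other one, then all forms of degree at least two on that conic extend by zero. -/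
theorem mem_map_conicPair {ε : MvPolynomial (Fin 2) ℂ →ₗ[ℂ]
      MvPolynomial (Fin 2) ℂ × MvPolynomial (Fin 2) ℂ}
    (hε : ∀ x y, (x, x) * ε y = ε (x * y)) {o e : CoordRing} (ho : o.IsHomogeneous 1)
    (he : e.IsHomogeneous 1) (hio : conicPair o = ε (MvPolynomial.X 0 * MvPolynomial.X 1))
    (hie : conicPair e = ε (MvPolynomial.X 0 ^ 2 + MvPolynomial.X 1 ^ 2)) {k : ℕ} (hk : 2 ≤ k)
    {r : MvPolynomial (Fin 2) ℂ} (hr : r.IsHomogeneous (2 * k)) :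
    ε r ∈ (MvPolynomial.homogeneousSubmodule (AutocovIndex q11) ℂ k).map
      conicPair.toLinearMap := by
  set M := (MvPolynomial.homogeneousSubmodule (AutocovIndex q11) ℂ k).map conicPair.toLinearMap
  -- The variables g11 and g1m restrict to s² and t² on both conics, so multiplying by them
  -- preserves vanishing on the other conic.
  have key : ∀ (p q : ℕ) (z : CoordRing) (n : ℕ) (y : MvPolynomial (Fin 2) ℂ),
      z.IsHomogeneous n → conicPair z = ε y → p + q + n = k →
      ε (MvPolynomial.X 0 ^ (2 * p) * MvPolynomial.X 1 ^ (2 * q) * y) ∈ M := by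
    intro p q z n y hz hzy hpq
    refine ⟨g11 ^ p * g1m ^ q * z, ?_, ?_⟩
    · have := ((isHomogeneous_g11.pow p).mul (isHomogeneous_g1m.pow q)).mul hz
      rwa [one_mul, one_mul, hpq] at this
    · rw [AlgHom.toLinearMap_apply, map_mul, map_mul, map_pow, map_pow, hzy, conicPair_g11,
        conicPair_g1m, Prod.pow_mk, Prod.pow_mk, mul_assoc, hε, hε, ← mul_assoc, ← pow_mul,
        ← pow_mul]
  have hodd : ∀ p q : ℕ, p + q + 1 = k →
      ε (MvPolynomial.X 0 ^ (2 * p + 1) * MvPolynomial.X 1 ^ (2 * q + 1)) ∈ M := by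
    intro p q h
    convert key p q o 1 _ ho hio h using 2
    ring
  have heven : ∀ p q : ℕ, p + q + 2 = k →
      ε (MvPolynomial.X 0 ^ (2 * p + 2) * MvPolynomial.X 1 ^ (2 * q + 2)) ∈ M := by
    intro p q h
    -- Since g01 restricts to 2st, its product with `o` gives 2s²t², which is then halved.
    have h1 := key p q (g01 * o) 2 _ (isHomogeneous_g01.mul ho)
      (by rw [map_mul, conicPair_g01, hio, hε]) h
    have h2 := M.smul_mem (1 / 2 : ℂ) h1
    rw [← map_smul] at h2
    convert h2 using 2
    rw [MvPolynomial.smul_eq_C_mul]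
    have : (MvPolynomial.C (1 / 2) * 2 : MvPolynomial (Fin 2) ℂ) = 1 := by
      rw [← map_ofNat (MvPolynomial.C : ℂ →+* MvPolynomial (Fin 2) ℂ) 2, ← map_mul]
      norm_num
    linear_combination -(MvPolynomial.X 0 ^ (2 * p + 2) * MvPolynomial.X 1 ^ (2 * q + 2)) * this
  obtain ⟨l, rfl⟩ := Nat.exists_eq_add_of_le' hk
  have hmem : ∀ i j : ℕ, i + j = 2 * (l + 2) →
      ε (MvPolynomial.X 0 ^ i * MvPolynomial.X 1 ^ j) ∈ M := by
    intro i j hij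
    obtain ⟨p, hp | hp⟩ := Nat.even_or_odd' i
    · rcases Nat.eq_zero_or_pos i with rfl | hi
      · obtain rfl : j = 2 * l + 4 := by omega
        -- A pure power is isolated by subtracting the mixed even monomial from a multiple of s² +
        -- t²; the mixed monomial is where degree at least 2 is needed.
        have h1 := key 0 (l + 1) e 1 _ he hie (by omega)
        have h2 := M.sub_mem h1 (heven 0 l (by omega))
        rw [← map_sub] at h2
        convert h2 using 2
        ring
      · rcases Nat.eq_zero_or_pos j with rfl | hj
        · obtain rfl : i = 2 * l + 4 := by omega
          have h1 := key (l + 1) 0 e 1 _ he hie (by omega)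
          have h2 := M.sub_mem h1 (heven l 0 (by omega))
          rw [← map_sub] at h2
          convert h2 using 2
          ring
        · obtain ⟨p, rfl⟩ : ∃ p, i = 2 * p + 2 := ⟨p - 1, by omega⟩
          obtain ⟨q, rfl⟩ : ∃ q, j = 2 * q + 2 := ⟨l - p, by omega⟩
          exact heven p q (by omega)
    · obtain ⟨q, rfl⟩ : ∃ q, j = 2 * q + 1 := ⟨l + 1 - p, by omega⟩
      subst hp
      exact hodd p q (by omega)
  have hle : MvPolynomial.homogeneousSubmodule (Fin 2) ℂ (2 * (l + 2)) ≤ M.comap ε := by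
    rw [homogeneousSubmodule_eq_span, Submodule.span_le]
    rintro _ ⟨d, hd, rfl⟩
    have hd' : d 0 + d 1 = 2 * (l + 2) := by
      rw [← Fin.sum_univ_two, ← Finsupp.degree_eq_sum]
      exact hd
    have := hmem _ _ hd'
    rw [← monomial_fin_two] at this
    exact this
  exact hle hr

/-- The conics are disjoint. The linear forms g01 + g10 and g00 + 2g11 + 2g1m vanish on the second,
g01 - g10 and 2g11 + 2g1m - g00 on the first; divided by 4 they restrict to st and s² + t² on the
remaining conic. In degree 1 the claim fails, as 5 linear forms cannot fill a space of dimension 6.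
-/
theorem map_conicPair {k : ℕ} (hk : 2 ≤ k) :
    (MvPolynomial.homogeneousSubmodule (AutocovIndex q11) ℂ k).map conicPair.toLinearMap =
      (MvPolynomial.homogeneousSubmodule (Fin 2) ℂ (2 * k)).prod
        (MvPolynomial.homogeneousSubmodule (Fin 2) ℂ (2 * k)) := by
  apply le_antisymm
  · rintro _ ⟨f, hf, rfl⟩
    exact ⟨isHomogeneous_aeval_of_isHomogeneous isHomogeneous_conicPoly₁ hf,
      isHomogeneous_aeval_of_isHomogeneous isHomogeneous_conicPoly₂ hf⟩
  · have h4 : (MvPolynomial.C (1 / 4) * 4 : MvPolynomial (Fin 2) ℂ) = 1 := by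
      rw [← map_ofNat (MvPolynomial.C : ℂ →+* MvPolynomial (Fin 2) ℂ) 4, ← map_mul]
      norm_num
    have hC : ∀ c : ℂ, conicPair (MvPolynomial.C c) = (MvPolynomial.C c, MvPolynomial.C c) := by
      intro c
      simp
    have hlin : (g00 + 2 * g11 + 2 * g1m).IsHomogeneous 1 ∧
        (2 * g11 + 2 * g1m - g00).IsHomogeneous 1 := by
      have h1 := isHomogeneous_ofNat_mul isHomogeneous_g11 2
      have h2 := isHomogeneous_ofNat_mul isHomogeneous_g1m 2
      exact ⟨(isHomogeneous_g00.add h1).add h2, (h1.add h2).sub isHomogeneous_g00⟩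
    rintro ⟨r₁, r₂⟩ ⟨h₁, h₂⟩
    have m1 := mem_map_conicPair (ε := LinearMap.inl ℂ _ _) (o := MvPolynomial.C (1 / 4) *
      (g01 + g10)) (e := MvPolynomial.C (1 / 4) * (g00 + 2 * g11 + 2 * g1m))
      (fun x y => by simp) ((isHomogeneous_g01.add isHomogeneous_g10).C_mul _)
      (hlin.1.C_mul _) ?_ ?_ hk h₁
    have m2 := mem_map_conicPair (ε := LinearMap.inr ℂ _ _) (o := MvPolynomial.C (1 / 4) *
      (g01 - g10)) (e := MvPolynomial.C (1 / 4) * (2 * g11 + 2 * g1m - g00))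
      (fun x y => by simp) ((isHomogeneous_g01.sub isHomogeneous_g10).C_mul _)
      (hlin.2.C_mul _) ?_ ?_ hk h₂
    · convert Submodule.add_mem _ m1 m2 using 1
      simp
    all_goals
      rw [map_mul, hC]
      simp only [conicPair_apply, map_add, map_sub, map_mul, map_ofNat, aeval_g00, aeval_g10,
        aeval_g01, aeval_g11, aeval_g1m, conicPoly₁, conicPoly₂, coords_l00, coords_l10,
        coords_l01, coords_l11, coords_l1m, LinearMap.inl_apply, LinearMap.inr_apply]
      refine Prod.ext ?_ ?_ <;>
      simp only [Prod.fst_mul, Prod.snd_mul, Prod.fst_add, Prod.snd_add, Prod.fst_sub,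
        Prod.snd_sub, Prod.fst_ofNat, Prod.snd_ofNat]
    · ring
    · linear_combination (MvPolynomial.X 0 * MvPolynomial.X 1) * h4
    · ring
    · linear_combination (MvPolynomial.X 0 ^ 2 + MvPolynomial.X 1 ^ 2) * h4
    · linear_combination (MvPolynomial.X 0 * MvPolynomial.X 1) * h4
    · ring
    · linear_combination (MvPolynomial.X 0 ^ 2 + MvPolynomial.X 1 ^ 2) * h4
    · ring

/-! ### The degree of the singular locus -/

theorem finrank_submodule_prod {K V V' : Type*} [Field K] [AddCommGroup V] [Module K V]
    [AddCommGroup V'] [Module K V'] (p : Submodule K V) (q : Submodule K V')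
    [FiniteDimensional K p] [FiniteDimensional K q] :
    Module.finrank K (p.prod q) = Module.finrank K p + Module.finrank K q := by
  have h : p.prod q = LinearMap.range (p.subtype.prodMap q.subtype) := by
    ext x
    simp
  rw [h, LinearMap.finrank_range_of_inj (p.injective_subtype.prodMap q.injective_subtype),
    Module.finrank_prod]

theorem mem_vanishingIdeal_singularLocus_iff {f : CoordRing} {m : ℕ} (hf : f.IsHomogeneous m) :
    f ∈ vanishingIdeal (singularLocus (MA q11)) ↔
      ((MvPolynomial.aeval segrePoly : CoordRing →ₐ[ℂ] _).prod conicPair).toLinearMap f = 0 := by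
  rw [singularLocus_MA, vanishingIdeal_union _ _ hf, vanishingIdeal_union _ _ hf, zeroLocus_P1_eq,
    zeroLocus_P2_eq, zeroLocus_P3_eq, mem_vanishingIdeal_parametrizedSet_iff conicPoly₁_ne_zero hf,
    mem_vanishingIdeal_parametrizedSet_iff conicPoly₂_ne_zero hf,
    mem_vanishingIdeal_parametrizedSet_iff segrePoly_ne_zero hf]
  change _ ↔ (MvPolynomial.aeval segrePoly f, MvPolynomial.aeval conicPoly₁ f,
    MvPolynomial.aeval conicPoly₂ f) = 0
  rw [Prod.mk_eq_zero, Prod.mk_eq_zero]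
  exact ⟨fun ⟨⟨h1, h2⟩, h3⟩ => ⟨h3, h1, h2⟩, fun ⟨h3, h1, h2⟩ => ⟨⟨h1, h2⟩, h3⟩⟩

theorem isHomogeneous_sq_sub_sq :
    (MvPolynomial.X 0 ^ 2 - MvPolynomial.X 1 ^ 2 : MvPolynomial (Fin 2) ℂ).IsHomogeneous 2 :=
  ((MvPolynomial.isHomogeneous_X _ _).pow 2).sub ((MvPolynomial.isHomogeneous_X _ _).pow 2)

theorem sq_sub_sq_ne_zero :
    (MvPolynomial.X 0 ^ 2 - MvPolynomial.X 1 ^ 2 : MvPolynomial (Fin 2) ℂ) ≠ 0 := by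
  intro h
  have := congrArg (MvPolynomial.eval ![1, 0]) h
  simp at this

/-- Each conic meets the quadric surface where s² = t², and both generators of `P3` restrict to
multiples of s² - t². -/
theorem dvd_of_mem_P3 {f : CoordRing} (hf : f ∈ P3) :
    MvPolynomial.X 0 ^ 2 - MvPolynomial.X 1 ^ 2 ∣ MvPolynomial.aeval conicPoly₁ f ∧
      MvPolynomial.X 0 ^ 2 - MvPolynomial.X 1 ^ 2 ∣ MvPolynomial.aeval conicPoly₂ f := by
  rw [P3, Ideal.mem_span_pair] at hf
  obtain ⟨x, y, rfl⟩ := hf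
  constructor <;> rw [map_add, map_mul, map_mul] <;>
    refine dvd_add (Dvd.dvd.mul_left ?_ _) (Dvd.dvd.mul_left ?_ _) <;>
    simp only [map_sub, map_mul, aeval_g00, aeval_g10, aeval_g01, aeval_g11, aeval_g1m, conicPoly₁,
      conicPoly₂, coords_l00, coords_l10, coords_l01, coords_l11, coords_l1m]
  · exact dvd_rfl
  · exact ⟨-2 * MvPolynomial.X 1 ^ 2, by ring⟩
  · exact dvd_rfl
  · exact ⟨2 * MvPolynomial.X 1 ^ 2, by ring⟩

/-- Rank–nullity for the projection to the Segre component: its image has dimension (k + 2)², and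
its kernel is a copy of the pairs of binary forms of degree 2k. -/
theorem hilbertFunction_singularLocus {k : ℕ} (hk : 2 ≤ k) :
    hilbertFunction (singularLocus (MA q11)) (k + 1) = 2 * (2 * k + 1) + (k + 2) ^ 2 := by
  rw [hilbertFunction_eq_finrank_map
    ((MvPolynomial.aeval segrePoly : CoordRing →ₐ[ℂ] _).prod conicPair).toLinearMap
    fun f hf => mem_vanishingIdeal_singularLocus_iff hf]
  set R := MvPolynomial.homogeneousSubmodule (AutocovIndex q11) ℂ (k + 1)
  set ψ := ((MvPolynomial.aeval segrePoly : CoordRing →ₐ[ℂ] _).prod conicPair).toLinearMap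
  set H := MvPolynomial.homogeneousSubmodule (Fin 2) ℂ (2 * k)
  set δ : MvPolynomial (Fin 2) ℂ := MvPolynomial.X 0 ^ 2 - MvPolynomial.X 1 ^ 2
  let L : MvPolynomial (Fin 2) ℂ × MvPolynomial (Fin 2) ℂ →ₗ[ℂ] MvPolynomial (Fin 4) ℂ ×
      (MvPolynomial (Fin 2) ℂ × MvPolynomial (Fin 2) ℂ) :=
    LinearMap.inr ℂ _ _ ∘ₗ LinearMap.mulLeft ℂ (δ, δ)
  have hL : Function.Injective L := by
    rintro ⟨x, y⟩ ⟨x', y'⟩ h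
    simp only [L, LinearMap.comp_apply, LinearMap.inr_apply, LinearMap.mulLeft_apply,
      Prod.mk_mul_mk, Prod.mk.injEq, true_and] at h
    rw [mul_left_cancel₀ sq_sub_sq_ne_zero h.1, mul_left_cancel₀ sq_sub_sq_ne_zero h.2]
  have hfst : (R.map ψ).map (LinearMap.fst ℂ _ _) = R.map
      (MvPolynomial.aeval segrePoly : CoordRing →ₐ[ℂ] MvPolynomial (Fin 4) ℂ).toLinearMap := by
    rw [← Submodule.map_comp]
    rfl
  -- Forms vanishing on the surface restrict to multiples of s² - t² on the conics. Conversely a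
  -- pair of such multiples comes from (g11 - g1m) g, where g has degree k and realizes the pair of
  -- quotients.
  have hker : R.map ψ ⊓ LinearMap.ker (LinearMap.fst ℂ _ _) = (H.prod H).map L := by
    apply le_antisymm
    · rintro _ ⟨⟨f, hf, rfl⟩, h0⟩
      have hf' : f.IsHomogeneous (k + 1) := hf
      have h0' : MvPolynomial.aeval segrePoly f = 0 := h0
      rw [← mem_vanishingIdeal_parametrizedSet_iff segrePoly_ne_zero hf', ← zeroLocus_P3_eq,
        vanishingIdeal_zeroLocus_P3] at h0'
      obtain ⟨⟨r₁, e₁⟩, ⟨r₂, e₂⟩⟩ := dvd_of_mem_P3 h0'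
      have d₁ := isHomogeneous_aeval_of_isHomogeneous isHomogeneous_conicPoly₁ hf'
      have d₂ := isHomogeneous_aeval_of_isHomogeneous isHomogeneous_conicPoly₂ hf'
      rw [e₁] at d₁
      rw [e₂] at d₂
      obtain ⟨s₁, hs₁, es₁⟩ := exists_isHomogeneous_mul_eq isHomogeneous_sq_sub_sq d₁
      obtain ⟨s₂, hs₂, es₂⟩ := exists_isHomogeneous_mul_eq isHomogeneous_sq_sub_sq d₂
      refine ⟨(s₁, s₂), ⟨hs₁, hs₂⟩, Prod.ext h0.symm (Prod.ext ?_ ?_)⟩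
      · exact es₁.trans e₁.symm
      · exact es₂.trans e₂.symm
    · rintro _ ⟨x, hx, rfl⟩
      rw [← map_conicPair hk] at hx
      obtain ⟨g, hg, rfl⟩ := hx
      refine ⟨⟨(g11 - g1m) * g, ?_, ?_⟩, ?_⟩
      · have := (isHomogeneous_g11.sub isHomogeneous_g1m).mul hg
        rwa [add_comm] at this
      · refine Prod.ext ?_ ?_
        · change MvPolynomial.aeval segrePoly ((g11 - g1m) * g) = 0
          rw [map_mul, map_sub, aeval_g11, aeval_g1m, segrePoly, coords_l11, coords_l1m, sub_self,
            zero_mul]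
        · change conicPair ((g11 - g1m) * g) = (δ, δ) * conicPair g
          rw [map_mul, map_sub, conicPair_g11, conicPair_g1m]
          rfl
      · rfl
  have hH : Module.finrank ℂ H = 2 * k + 1 := by
    rw [finrank_homogeneousSubmodule, Fintype.card_fin, show 2 + 2 * k - 1 = 2 * k + 1 by omega,
      Nat.choose_succ_self_right]
  have : FiniteDimensional ℂ (R.map ψ) := inferInstance
  rw [← finrank_map_add_finrank_inf_ker (R.map ψ) (LinearMap.fst ℂ _ _), hfst, hker,
    finrank_map_segrePoly, ← (Submodule.equivMapOfInjective L hL (H.prod H)).finrank_eq,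
    finrank_submodule_prod, hH]
  ring

theorem hasDegree_singularLocus_MA : HasDegree (singularLocus (MA q11)) 2 := by
  -- With n = k + 1 the count is (n + 1)² + 2(2n - 1) = n² + 6n - 1.
  refine ⟨Polynomial.C 1 * Polynomial.X ^ 2 + Polynomial.C 6 * Polynomial.X +
    Polynomial.C (-1), ?_, ?_⟩
  · filter_upwards [Filter.eventually_ge_atTop 3] with n hn
    obtain ⟨k, rfl⟩ : ∃ k, n = k + 1 := ⟨n - 1, by omega⟩
    rw [hilbertFunction_singularLocus (by omega)]
    simp
    ring
  · rw [Polynomial.leadingCoeff_quadratic one_ne_zero, Polynomial.natDegree_quadratic one_ne_zero]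
    norm_num [Nat.factorial]

/-! ### The components of the singular locus -/

theorem not_subset_components :
    (¬ zeroLocus (P1 : Set CoordRing) ⊆ zeroLocus (P2 : Set CoordRing) ∧
      ¬ zeroLocus (P1 : Set CoordRing) ⊆ zeroLocus (P3 : Set CoordRing)) ∧
    (¬ zeroLocus (P2 : Set CoordRing) ⊆ zeroLocus (P1 : Set CoordRing) ∧
      ¬ zeroLocus (P2 : Set CoordRing) ⊆ zeroLocus (P3 : Set CoordRing)) ∧
    (¬ zeroLocus (P3 : Set CoordRing) ⊆ zeroLocus (P1 : Set CoordRing) ∧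
      ¬ zeroLocus (P3 : Set CoordRing) ⊆ zeroLocus (P2 : Set CoordRing)) := by
  have v₁ : coords (2 : ℂ) 0 0 1 0 ≠ 0 := by simp [coords_ne_zero_iff]
  have v₂ : coords (-2 : ℂ) 0 0 1 0 ≠ 0 := by simp [coords_ne_zero_iff]
  have v₃ : coords (1 : ℂ) 0 0 0 0 ≠ 0 := by simp [coords_ne_zero_iff]
  have m₁ : point _ v₁ ∈ zeroLocus (P1 : Set CoordRing) := by
    simp [point_mem_zeroLocus_P1_iff]
  have m₂ : point _ v₂ ∈ zeroLocus (P2 : Set CoordRing) := by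
    simp [point_mem_zeroLocus_P2_iff]
  have m₃ : point _ v₃ ∈ zeroLocus (P3 : Set CoordRing) := by
    simp [point_mem_zeroLocus_P3_iff]
  refine ⟨⟨fun h => ?_, fun h => ?_⟩, ⟨fun h => ?_, fun h => ?_⟩, fun h => ?_, fun h => ?_⟩
  · have := (point_mem_zeroLocus_P2_iff v₁).1 (h m₁)
    norm_num at this
  · have := (point_mem_zeroLocus_P3_iff v₁).1 (h m₁)
    norm_num at this
  · have := (point_mem_zeroLocus_P1_iff v₂).1 (h m₂)
    norm_num at this
  · have := (point_mem_zeroLocus_P3_iff v₂).1 (h m₂)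
    norm_num at this
  · have := (point_mem_zeroLocus_P1_iff v₃).1 (h m₃)
    norm_num at this
  · have := (point_mem_zeroLocus_P2_iff v₃).1 (h m₃)
    norm_num at this

theorem irreducibleComponents_singularLocus_MA :
    (fun C : Set ↥(singularLocus (MA q11)) => Subtype.val '' C) ''
        irreducibleComponents ↥(singularLocus (MA q11)) =
      {zeroLocus (P1 : Set CoordRing), zeroLocus (P2 : Set CoordRing),
        zeroLocus (P3 : Set CoordRing)} := by
  classical
  obtain ⟨⟨h12, h13⟩, ⟨h21, h23⟩, ⟨h31, h32⟩⟩ := not_subset_components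
  have h := image_irreducibleComponents_eq (S := singularLocus (MA q11))
    {zeroLocus (P1 : Set CoordRing), zeroLocus (P2 : Set CoordRing),
      zeroLocus (P3 : Set CoordRing)} ?_ ?_ ?_ ?_
  · simpa using h
  · simp [singularLocus_MA, Set.union_assoc]
  · simp [isClosed_zeroLocus]
  · simp [isIrreducible_zeroLocus_P1, isIrreducible_zeroLocus_P2, isIrreducible_zeroLocus_P3]
  · simp [h12, h13, h21, h23, h31, h32]

end AutocovVariety

theorem theorem3p2 :
    -- the variety is a threefold of degree 4
    (IsClosed (MA q11) ∧
      IsIrreducible (MA q11) ∧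
      topologicalKrullDim (MA q11) = 3 ∧
      HasDegree (MA q11) 4) ∧
    -- it is the hypersurface defined by the quartic, which generates its ideal
    (MA q11 =
        zeroLocus {quartic} ∧
      vanishingIdeal (MA q11) =
        Ideal.span {quartic}) ∧
    -- the singular locus has dimension 2 and degree 2
    (topologicalKrullDim
        (singularLocus (MA q11)) = 2 ∧
      HasDegree
        (singularLocus (MA q11)) 2) ∧
    -- the three ideals are prime
    (P1.IsPrime ∧ P2.IsPrime ∧ P3.IsPrime) ∧
    -- they are the ideals of their zero loci
    (vanishingIdeal (zeroLocus P1) =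
        P1 ∧
      vanishingIdeal (zeroLocus P2) =
        P2 ∧
      vanishingIdeal (zeroLocus P3) =
        P3) ∧
    -- the singular locus is the union of the three zero loci
    singularLocus (MA q11) =
      zeroLocus P1 ∪
      zeroLocus P2 ∪
      zeroLocus P3 ∧
    -- these are its irreducible components, and they are pairwise distinct
    (fun C : Set ↥(singularLocus
        (MA q11)) => Subtype.val '' C) ''
        irreducibleComponents ↥(singularLocus
          (MA q11)) =
      {zeroLocus P1,
        zeroLocus P2,
        zeroLocus P3} ∧
    (zeroLocus (P1 : Set CoordRing) ≠
        zeroLocus P2 ∧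
      zeroLocus (P1 : Set CoordRing) ≠
        zeroLocus P3 ∧
      zeroLocus (P2 : Set CoordRing) ≠
        zeroLocus P3) := by
  obtain ⟨⟨h12, h13⟩, ⟨-, h23⟩, -⟩ := not_subset_components
  exact ⟨⟨isClosed_MA, isIrreducible_MA, topologicalKrullDim_MA, hasDegree_MA⟩,
    ⟨MA_eq_zeroLocus, vanishingIdeal_MA⟩,
    ⟨topologicalKrullDim_singularLocus_MA, hasDegree_singularLocus_MA⟩,
    ⟨isPrime_P1, isPrime_P2, isPrime_P3⟩,
    ⟨vanishingIdeal_zeroLocus_P1, vanishingIdeal_zeroLocus_P2, vanishingIdeal_zeroLocus_P3⟩,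
    singularLocus_MA, irreducibleComponents_singularLocus_MA,
    fun h => h12 h.subset, fun h => h13 h.subset, fun h => h23 h.subset⟩
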